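/- Let $R$ be a 2-fir, i.e. a ring in which every right ideal generated by at most two elements is free of unique rank (so $R$ is a domain). An atom is a nonzero non-unit that is not a product of two non-units. For $a\in R$ let $\ell(a)$ be the least number of atoms in a factorization of $a$ into atoms, with $\ell(a)=0$ for units $a$ and $\ell(a)=\infty$ if $a$ is neither a unit nor a product of atoms; let $\mathcal F=\{a\in R:\ell(a)<\infty\}$. Nonzero elements $a,a'$ are similar if $R/Ra\cong R/Ra'$ as left $R$-modules; $\Delta(a)$ denotes the similarity class of $a$. An empty intersection of left ideals is $R$. A set $\Delta$ of non-units of $\mathcal F$ is $F$-algebraic if $\bigcap_{\delta\in\Delta}R\delta\neq 0$. An element $d\in\mathcal F$ is $F$-dependent on $\Delta$ if $\Delta\cup\{d\}$ is $F$-algebraic and $Rd+\bigcap_{\gamma\in\Gamma}R\gamma\neq R$ for some finite $\Gamma\subseteq\Delta$. An $F$-algebraic set $\Delta$ is $F$-independent if no $\delta\in\Delta$ is $F$-dependent on $\Delta\setminus\{\delta\}$. An $F$-basis of $\Delta$ is an $F$-independent subset $B\subseteq\Delta$ on which every element of $\Delta$ is $F$-dependent. For $a\in R$ put $V(a)=\{p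 \text{ an atom}: a\in Rp\}$. For an atom $q$ let $C(q)=\operatorname{End}_R(R/Rq)$ and let $\lambda_{f,q}:R/Rq\to R/Rq$ be the $C(q)$-linear map $x+Rq\mapsto fx+Rq$. A factor of $f$ is a non-unit $g$ with $f=xgy$ for some $x,y\in R$; factors $g,h$ of $f$ are neighbouring if $f=xghy$ for some $x,y\in R$. An element $f\in\mathcal F$ is fully reducible if $Rf=\bigcap_{i=1}^nRp_i$ for some $n\ge 0$ and atoms $p_1,\dots,p_n$. Theorem. Let $f\in\mathcal F$. For every atom $q$ the ring $C(q)$ is a division ring. The set $V(f)$ has an $F$-basis, and all $F$-bases of $V(f)$ have the same number $\operatorname{rk}V(f)$ of elements. The set $V(f)$ meets only finitely many similarity classes. Let $q_1,\dots,q_r$ be any atoms representing, without repetition, the similarity classes met by $V(f)$, so that $V(f)=\bigcup_{i=1}^r(V(f)\cap\Delta(q_i))$. Then the following are equivalent: (i) $f$ is fully reducible. (ii) $\operatorname{rk}V(f)=\ell(f)$. (iii) $\ell(f)=\sum_{i=1}^r\dim_{C(q_i)}\ker\lambda_{f,q_i}$. (iv) There are $n\ge 0$ and atoms $p_1,\dots,p_n$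 such that $R/Rf\cong\bigoplus_{i=1}^nR/Rp_i$ as left $R$-modules. (v) All factors of $f$ are fully reducible. (vi) Every product $gh$ of two neighbouring factors $g,h$ of $f$ is fully reducible. (vii) Every product $gh$ of two neighbouring factors $g,h$ of $f$ that are atoms is fully reducible. (viii) For every $g\in R$, if $V(f)\subseteq V(g)$, then $g\in Rf$. -/

import Mathlib

universe u

namespace TwoFir

section

variable {R : Type u} [Ring R]

/-- A ring is a 2-fir if every right ideal generated by at most two elements is free of unique
rank. Right ideals are submodules of `R` over the opposite ring. As the right ideals in question
are finitely generated, only finite bases matter. -/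
def IsTwoFir (R : Type u) [Ring R] : Prop :=
  ∀ a b : R, ∃! n : ℕ,
    Nonempty (Module.Basis (Fin n) Rᵐᵒᵖ (Submodule.span Rᵐᵒᵖ ({a, b} : Set R)))

/-- The principal left ideal `Ra`. Atoms of `R` are the elements `p` with `Irreducible p`. -/
abbrev leftIdeal (a : R) : Submodule R R := Submodule.span R {a}

/-- The cyclic left module `R/Ra`. -/
abbrev CyclicModule (a : R) : Type u := R ⧸ leftIdeal a

/-- Similarity of nonzero elements: `R/Ra ≅ R/Ra'` as left modules. -/
def IsSimilar (a a' : R) : Prop :=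
  a ≠ 0 ∧ a' ≠ 0 ∧ Nonempty (CyclicModule a ≃ₗ[R] CyclicModule a')

/-- The similarity class `Δ(a)`. -/
def simClass (a : R) : Set R := {b | IsSimilar a b}

/-- `a` is a product of `n` atoms; for `n = 0` this means that `a` is a unit. -/
def IsProductOfAtoms (a : R) (n : ℕ) : Prop :=
  (IsUnit a ∧ n = 0) ∨
    ∃ l : List R, l.length = n ∧ (∀ p ∈ l, Irreducible p) ∧ l.prod = a

/-- The length `ℓ(a)`: the least number of atoms in an atomic factorization of `a`, and `⊤` if
there is no such factorization. -/
noncomputable def len (a : R) : ℕ∞ := ⨅ (n : ℕ) (_ : IsProductOfAtoms a n), (n : ℕ∞)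

/-- The set `𝓕` of the elements of finite length. -/
def finLen (R : Type u) [Ring R] : Set R := {a | len a < ⊤}

/-- `F`-algebraic sets (of non-units of finite length); the empty intersection is `R`. -/
def IsFAlgebraic (Δ : Set R) : Prop :=
  (∀ δ ∈ Δ, δ ∈ finLen R ∧ ¬ IsUnit δ) ∧ (⨅ δ ∈ Δ, leftIdeal δ) ≠ ⊥

/-- `d` is `F`-dependent on `Δ`. -/
def IsFDependent (d : R) (Δ : Set R) : Prop :=
  IsFAlgebraic (Δ ∪ {d}) ∧
    ∃ Γ : Finset R, (Γ : Set R) ⊆ Δ ∧ leftIdeal d ⊔ (⨅ γ ∈ Γ, leftIdeal γ) ≠ ⊤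

/-- `Δ` is an `F`-independent (`F`-algebraic) set. -/
def IsFIndependent (Δ : Set R) : Prop :=
  IsFAlgebraic Δ ∧ ∀ δ ∈ Δ, ¬ IsFDependent δ (Δ \ {δ})

/-- `B` is an `F`-basis of `Δ`. -/
def IsFBasis (B Δ : Set R) : Prop :=
  B ⊆ Δ ∧ IsFIndependent B ∧ ∀ d ∈ Δ, IsFDependent d B

/-- The rank of an `F`-algebraic set of atoms: the number of elements of an `F`-basis. (All
`F`-bases of an `F`-algebraic set of atoms of finite rank have the same number of elements; the
infimum just selects this value.) -/
noncomputable def rk (Δ : Set R) : ℕ∞ := ⨅ (B : Set R) (_ : IsFBasis B Δ), B.encard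

/-- `V(a)`: the set of atoms `p` with `a ∈ Rp`. -/
def V (a : R) : Set R := {p | Irreducible p ∧ a ∈ leftIdeal p}

/-- The ring `C(q) = End_R(R/Rq)`; it acts on `R/Rq` by evaluation. -/
abbrev C (q : R) : Type u := Module.End R (CyclicModule q)

/-- The `C(q)`-linear map `λ_{f,q} : R/Rq → R/Rq`, `x + Rq ↦ fx + Rq`. -/
def lam (f q : R) : CyclicModule q →ₗ[C q] CyclicModule q where
  toFun m := f • m
  map_add' := smul_add f
  map_smul' φ m := (φ.map_smul f m).symm

/-- `dim_{C(q)} ker λ_{f,q}`. -/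
noncomputable def dimKer (f q : R) : ℕ∞ :=
  Cardinal.toENat (Module.rank (C q) (LinearMap.ker (lam f q)))

/-- The atoms `q 0, …, q (r - 1)` represent, without repetition, the similarity classes
that meet `V(f)`. -/
structure IsSimDecomposition (f : R) {r : ℕ} (q : Fin r → R) : Prop where
  atom : ∀ i, Irreducible (q i)
  not_similar : ∀ i j, i ≠ j → ¬ IsSimilar (q i) (q j)
  meets : ∀ i, (V f ∩ simClass (q i)).Nonempty
  cover : V f = ⋃ i, V f ∩ simClass (q i)

/-- Fully reducible elements (units are included, by the empty intersection). -/
def IsFullyReducible (f : R) : Prop :=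
  f ∈ finLen R ∧
    ∃ (n : ℕ) (p : Fin n → R), (∀ i, Irreducible (p i)) ∧ leftIdeal f = ⨅ i, leftIdeal (p i)

/-- `g` is a factor of `f`: a non-unit with `f = x g y` for some `x, y`. -/
def IsFactor (g f : R) : Prop := ¬ IsUnit g ∧ ∃ x y : R, f = x * g * y

/-- The factors `g` and `h` are neighbouring factors (in this order) of `f`. -/
def AreNeighbouringFactors (g h f : R) : Prop :=
  IsFactor g f ∧ IsFactor h f ∧ ∃ x y : R, f = x * g * h * y

end

end TwoFir

/-! Let `Rm` be the intersection of all `Rp` with `p ∈ V(f)`. In a 2-fir, principal left ideals with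
a common nonzero multiple have principal sum and intersection (`IsTwoFir.exists_sup_inf`), so they
behave like a modular lattice of finite length. Intersecting with an atom not already present adds
exactly one to the length (`IsTwoFir.exists_inf_atom`), and lengths of factorizations are additive
and unique. Hence `Rm` is cut out by a finite irredundant set `Γ ⊆ V(f)` with `|Γ| = ℓ(m)`, and such
sets are exactly the `F`-bases of `V(f)` (`IsMeetBasis`).

As `f ∈ Rm`, conditions (i), (ii) and (viii) all say that `Rm = Rf`. For (iii) and (iv), a Chinese
remainder argument gives `R/Rm ≅ ⨁ R/Rγ` over `γ ∈ Γ`. The kernel of `λ_{f,q}` consists of the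
elements of `R/Rq` killed by `m`, so by a Schur lemma for atoms its dimension counts the `γ ∈ Γ`
similar to `q` (`IsMeetBasis.dimKer_eq`). For the conditions on factors, the annihilator of a
torsion element of `R/Rt`, with `t` an atom, is `R` or generated by an atom. Therefore full
reducibility passes to factors, and an induction on length recovers it from products of two
neighbouring atoms.

The definition of a 2-fir only concerns right ideals. The passage to left ideals goes through the
relation module of two elements, which is free of rank one when their right ideals meet
(`IsTwoFir.exists_right_relations`). -/

namespace TwoFir

/-! ### Split surjections and additivity of rank. -/

section Splitting

variable {S : Type*} [Ring S] {M N : Type*} [AddCommGroup M] [Module S M] [AddCommGroup N]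
  [Module S N]

/-- The projection onto the kernel of a linear map determined by a section. -/
def kerProj (f : M →ₗ[S] N) (g : N →ₗ[S] M) (h : f ∘ₗ g = LinearMap.id) :
    M →ₗ[S] LinearMap.ker f :=
  (LinearMap.id - g ∘ₗ f).codRestrict (LinearMap.ker f) fun x => by
    have := LinearMap.congr_fun h (f x)
    simp only [LinearMap.comp_apply, LinearMap.id_apply] at this
    simp [this]

theorem kerProj_coe (f : M →ₗ[S] N) (g : N →ₗ[S] M) (h : f ∘ₗ g = LinearMap.id) (x : M) :
    (kerProj f g h x : M) = x - g (f x) := rfl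

theorem kerProj_of_mem (f : M →ₗ[S] N) (g : N →ₗ[S] M) (h : f ∘ₗ g = LinearMap.id)
    (x : LinearMap.ker f) : kerProj f g h x = x := by
  ext
  simp [kerProj_coe]

/-- A linear map with a section identifies its domain with the codomain times the kernel. -/
noncomputable def prodKerEquiv (f : M →ₗ[S] N) (g : N →ₗ[S] M) (h : f ∘ₗ g = LinearMap.id) :
    M ≃ₗ[S] N × LinearMap.ker f :=
  LinearEquiv.ofBijective (f.prod (kerProj f g h)) (by
    have hs : ∀ y, f (g y) = y := fun y => LinearMap.congr_fun h y
    constructor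
    · rw [← LinearMap.ker_eq_bot, LinearMap.ker_eq_bot']
      intro x hx
      have h1 : f x = 0 := congrArg Prod.fst hx
      have h2 : ((kerProj f g h x : LinearMap.ker f) : M) = 0 :=
        congrArg Subtype.val (congrArg Prod.snd hx)
      simpa [kerProj_coe, h1] using h2
    · rintro ⟨y, k⟩
      refine ⟨g y + k, Prod.ext ?_ (Subtype.ext ?_)⟩
      · simp [hs]
      · simp [kerProj_coe, hs])

theorem exists_basis_add (f : M →ₗ[S] N) (g : N →ₗ[S] M) (h : f ∘ₗ g = LinearMap.id) {n m : ℕ}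
    (b : Module.Basis (Fin n) S N) (c : Module.Basis (Fin m) S (LinearMap.ker f)) :
    Nonempty (Module.Basis (Fin (n + m)) S M) :=
  ⟨((b.prod c).map (prodKerEquiv f g h).symm).reindex finSumFinEquiv⟩

theorem span_kerProj_pair (f : M →ₗ[S] N) (g : N →ₗ[S] M) (h : f ∘ₗ g = LinearMap.id) {x y : M}
    (hxy : Submodule.span S {x, y} = ⊤) :
    Submodule.span S {kerProj f g h x, kerProj f g h y} = ⊤ := by
  rw [← Set.image_pair, ← Submodule.map_span, hxy, Submodule.map_top, LinearMap.range_eq_top]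
  exact fun k => ⟨k, kerProj_of_mem f g h k⟩

end Splitting

/-! ### Right ideals of a 2-fir: rank counts. -/

section RightIdeals

variable {R : Type u} [Ring R]

/-- A module spanned by two elements that embeds in `R` has a basis, of unique size. -/
theorem IsTwoFir.existsUnique_basis (hR : IsTwoFir R) {K : Type*} [AddCommGroup K] [Module Rᵐᵒᵖ K]
    (i : K →ₗ[Rᵐᵒᵖ] R) (hi : Function.Injective i) {x y : K}
    (hxy : Submodule.span Rᵐᵒᵖ {x, y} = ⊤) :
    ∃! n : ℕ, Nonempty (Module.Basis (Fin n) Rᵐᵒᵖ K) := by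
  have hr : Submodule.span Rᵐᵒᵖ {i x, i y} = LinearMap.range i := by
    rw [← Set.image_pair, ← Submodule.map_span, hxy, Submodule.map_top]
  have e : K ≃ₗ[Rᵐᵒᵖ] Submodule.span Rᵐᵒᵖ {i x, i y} :=
    (LinearEquiv.ofInjective i hi).trans (LinearEquiv.ofEq _ _ hr.symm)
  obtain ⟨n, ⟨b⟩, hn⟩ := hR (i x) (i y)
  exact ⟨n, ⟨b.map e.symm⟩, fun m ⟨c⟩ => hn m ⟨c.map e⟩⟩

theorem span_one_one : Submodule.span Rᵐᵒᵖ {(1 : R), 1} = ⊤ := by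
  rw [Submodule.eq_top_iff']
  intro x
  rw [Submodule.mem_span_pair]
  exact ⟨MulOpposite.op x, 0, by simp⟩

theorem IsTwoFir.basis_self (hR : IsTwoFir R) {n : ℕ} (b : Module.Basis (Fin n) Rᵐᵒᵖ R) :
    n = 1 := by
  obtain ⟨k, -, hk⟩ := hR.existsUnique_basis LinearMap.id Function.injective_id
    (span_one_one (R := R))
  rw [hk n ⟨b⟩]
  refine (hk 1 ⟨?_⟩).symm
  refine (Module.Basis.singleton (Fin 1) Rᵐᵒᵖ).map (LinearEquiv.symm ?_)
  exact { MulOpposite.opAddEquiv with map_smul' := fun r x => by simp }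

theorem IsTwoFir.nontrivial (hR : IsTwoFir R) : Nontrivial R := by
  by_contra h
  rw [not_nontrivial_iff_subsingleton] at h
  have : Subsingleton Rᵐᵒᵖ := MulOpposite.unop_injective.subsingleton
  exact absurd (hR.basis_self (Module.Basis.ofRepr (ι := Fin 0)
    { toFun := 0, invFun := 0, left_inv := fun _ => Subsingleton.elim _ _,
      right_inv := fun _ => Subsingleton.elim _ _, map_add' := by simp, map_smul' := by simp }))
    (by norm_num)

/-- Left multiplication, as a map of right modules. -/
def mulLeftHom (a : R) : R →ₗ[Rᵐᵒᵖ] R where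
  toFun x := a * x
  map_add' := mul_add a
  map_smul' r x := by simp [mul_assoc]

/-- The map `(u, v) ↦ xu + yv` of right modules. -/
def pairHom (x y : R) : (R × R) →ₗ[Rᵐᵒᵖ] R := (mulLeftHom x).coprod (mulLeftHom y)

theorem pairHom_apply (x y u v : R) : pairHom x y (u, v) = x * u + y * v := rfl

theorem span_prod_pair : Submodule.span Rᵐᵒᵖ {((1 : R), (0 : R)), (0, 1)} = ⊤ := by
  rw [Submodule.eq_top_iff']
  rintro ⟨u, v⟩
  rw [Submodule.mem_span_pair]
  exact ⟨MulOpposite.op u, MulOpposite.op v, by simp⟩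

/-- The right ideal `aR` is free, so `R ≅ aR ⊕ ann(a)`. The summand `ann(a)` is again cyclic, hence
free, and the two ranks add up to 1, so one of the summands vanishes. -/
theorem IsTwoFir.noZeroDivisors (hR : IsTwoFir R) : NoZeroDivisors R := by
  refine ⟨fun {a b} hab => ?_⟩
  set f := (mulLeftHom a).rangeRestrict with hf
  have hfs : Function.Surjective f := (mulLeftHom a).surjective_rangeRestrict
  obtain ⟨n, ⟨bn⟩, -⟩ := hR.existsUnique_basis (LinearMap.range (mulLeftHom a)).subtype
    Subtype.val_injective (x := f 1) (y := f 1) (by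
      rw [← Set.image_pair, ← Submodule.map_span, span_one_one, Submodule.map_top,
        LinearMap.range_eq_top.2 hfs])
  have := Module.Projective.of_basis bn
  obtain ⟨g, hg⟩ := Module.projective_lifting_property f LinearMap.id hfs
  obtain ⟨m, ⟨bm⟩, -⟩ := hR.existsUnique_basis (LinearMap.ker f).subtype
    Subtype.val_injective (span_kerProj_pair f g hg span_one_one)
  obtain ⟨c⟩ := exists_basis_add f g hg bn bm
  have hnm := hR.basis_self c
  rcases Nat.eq_zero_or_pos n with h0 | h0
  · subst h0
    left
    have : Subsingleton (LinearMap.range (mulLeftHom a)) := bn.repr.toEquiv.subsingleton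
    have h1 : a * 1 = 0 := congrArg Subtype.val (Subsingleton.elim (f 1) 0)
    rwa [mul_one] at h1
  · obtain rfl : m = 0 := by omega
    right
    have : Subsingleton (LinearMap.ker f) := bm.repr.toEquiv.subsingleton
    have hb : b ∈ LinearMap.ker f := by
      rw [LinearMap.mem_ker]
      exact Subtype.ext hab
    exact congrArg Subtype.val (Subsingleton.elim (⟨b, hb⟩ : LinearMap.ker f) 0)

theorem IsTwoFir.isDomain (hR : IsTwoFir R) : IsDomain R := by
  have := hR.nontrivial
  have := hR.noZeroDivisors
  exact NoZeroDivisors.to_isDomain R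

/-- If every two nonzero right ideals meet, free modules that embed in `R` have rank at most
one. -/
theorem basis_card_le_one (hO : ∀ a b : R, a ≠ 0 → b ≠ 0 → ∃ u v, a * u = b * v ∧ a * u ≠ 0)
    {K : Type*} [AddCommGroup K] [Module Rᵐᵒᵖ K] (i : K →ₗ[Rᵐᵒᵖ] R) (hi : Function.Injective i)
    [Nontrivial R] {n : ℕ} (b : Module.Basis (Fin n) Rᵐᵒᵖ K) : n ≤ 1 := by
  by_contra! hn
  have h0 : ∀ j, i (b j) ≠ 0 := fun j h => b.ne_zero j (hi (h.trans (map_zero i).symm))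
  let j₀ : Fin n := ⟨0, by omega⟩
  let j₁ : Fin n := ⟨1, hn⟩
  obtain ⟨u, v, huv, hne⟩ := hO _ _ (h0 j₀) (h0 j₁)
  have h1 : MulOpposite.op u • b j₀ = MulOpposite.op v • b j₁ := by
    apply hi
    simpa using huv
  have h2 := congrArg (fun k => b.repr k j₀) h1
  have h3 : j₁ ≠ j₀ := by simp [j₀, j₁]
  simp [h3] at h2
  simp [h2] at hne

/-- The structure of two right ideals with nonzero intersection in a 2-fir. -/
theorem IsTwoFir.exists_right_relations (hR : IsTwoFir R) {x y a b : R} (hab : x * a + y * b = 0)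
    (hne : x * a ≠ 0) :
    (∃ d x' y' r s, x = d * x' ∧ y = d * y' ∧ x' * r + y' * s = 1) ∧
      ∃ p q, ∀ u v, x * u + y * v = 0 ↔ ∃ w, u = p * w ∧ v = q * w := by
  have := hR.isDomain
  have hx : x ≠ 0 := left_ne_zero_of_mul hne
  have ha : a ≠ 0 := right_ne_zero_of_mul hne
  have hy : y ≠ 0 := by rintro rfl; simp [ha, hx] at hab
  set f := (pairHom x y).rangeRestrict with hf
  have hfs : Function.Surjective f := (pairHom x y).surjective_rangeRestrict
  have hfv : ∀ u v, ((f (u, v) : LinearMap.range (pairHom x y)) : R) = x * u + y * v :=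
    fun _ _ => rfl
  obtain ⟨n, ⟨bn⟩, -⟩ := hR.existsUnique_basis (LinearMap.range (pairHom x y)).subtype
    Subtype.val_injective (x := f (1, 0)) (y := f (0, 1)) (by
      rw [← Set.image_pair, ← Submodule.map_span, span_prod_pair, Submodule.map_top,
        LinearMap.range_eq_top.2 hfs])
  have := Module.Projective.of_basis bn
  obtain ⟨g, hg⟩ := Module.projective_lifting_property f LinearMap.id hfs
  have hker : ∀ u v, (u, v) ∈ LinearMap.ker f ↔ x * u + y * v = 0 := fun u v => by
    rw [LinearMap.mem_ker, ← hfv]; exact Subtype.ext_iff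
  -- A relation `x * u + y * v = 0` is determined by `u` because `y ≠ 0`, so the relation module
  -- embeds in `R` and is itself free.
  set i : LinearMap.ker f →ₗ[Rᵐᵒᵖ] R := LinearMap.fst Rᵐᵒᵖ R R ∘ₗ (LinearMap.ker f).subtype with hi
  have hii : Function.Injective i := by
    rw [← LinearMap.ker_eq_bot, LinearMap.ker_eq_bot']
    rintro ⟨⟨u, v⟩, hk⟩ (h0 : u = 0)
    subst h0
    rw [hker, mul_zero, zero_add] at hk
    simp [(mul_eq_zero.1 hk).resolve_left hy]
  obtain ⟨m, ⟨bm⟩, -⟩ := hR.existsUnique_basis i hii (span_kerProj_pair f g hg span_prod_pair)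
  have hn0 : n ≠ 0 := by
    rintro rfl
    have : Subsingleton (LinearMap.range (pairHom x y)) := bn.repr.toEquiv.subsingleton
    have h1 := congrArg Subtype.val (Subsingleton.elim (f (1, 0)) 0)
    rw [hfv] at h1
    simp [hx] at h1
  have hm0 : m ≠ 0 := by
    rintro rfl
    have : Subsingleton (LinearMap.ker f) := bm.repr.toEquiv.subsingleton
    have h1 := Subsingleton.elim (⟨(a, b), (hker a b).2 hab⟩ : LinearMap.ker f) 0
    exact ha (congrArg (fun k : LinearMap.ker f => k.1.1) h1)
  -- If any two nonzero right ideals meet, both ranks are at most 1. Otherwise some `cR ∩ dR = 0`,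
  -- so `R × R` embeds in `R` as a 2-generated right ideal and has unique rank 2, whence `n + m =
  -- 2`.
  have hnm : n = 1 ∧ m = 1 := by
    by_cases hO : ∀ a b : R, a ≠ 0 → b ≠ 0 → ∃ u v, a * u = b * v ∧ a * u ≠ 0
    · have h1 := basis_card_le_one hO (LinearMap.range (pairHom x y)).subtype
        Subtype.val_injective bn
      have h2 := basis_card_le_one hO i hii bm
      omega
    · push Not at hO
      obtain ⟨c, d, hc, hd, hcd⟩ := hO
      obtain ⟨c'⟩ := exists_basis_add f g hg bn bm
      have hinj : Function.Injective (pairHom c d) := by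
        rw [← LinearMap.ker_eq_bot, LinearMap.ker_eq_bot']
        rintro ⟨u, v⟩ h
        rw [pairHom_apply] at h
        have h1 := hcd u (-v) (by rw [mul_neg]; exact eq_neg_of_add_eq_zero_left h)
        rw [h1, zero_add] at h
        simp [(mul_eq_zero.1 h1).resolve_left hc, (mul_eq_zero.1 h).resolve_left hd]
      obtain ⟨k, -, hk⟩ := hR.existsUnique_basis (pairHom c d) hinj span_prod_pair
      have h2 : Nonempty (Module.Basis (Fin (1 + 1)) Rᵐᵒᵖ (R × R)) := by
        let e : Rᵐᵒᵖ ≃ₗ[Rᵐᵒᵖ] R :=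
          LinearEquiv.symm { MulOpposite.opAddEquiv with map_smul' := fun r x => by simp }
        let b₁ := (Module.Basis.singleton (Fin 1) Rᵐᵒᵖ).map e
        exact ⟨(b₁.prod b₁).reindex finSumFinEquiv⟩
      have h3 := hk _ h2
      have h4 := hk _ ⟨c'⟩
      omega
  obtain ⟨rfl, rfl⟩ := hnm
  constructor
  · have hdr : ∀ z, ∃ z', f z = MulOpposite.op z' • bn 0 := fun z =>
      ⟨(bn.repr (f z) 0).unop, by simpa using (bn.sum_repr (f z)).symm⟩
    obtain ⟨⟨r, s⟩, hrs⟩ := hfs (bn 0)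
    obtain ⟨x', hx'⟩ := hdr (1, 0)
    obtain ⟨y', hy'⟩ := hdr (0, 1)
    have hx'' : x = (bn 0 : LinearMap.range (pairHom x y)).1 * x' := by
      simpa [hfv] using congrArg Subtype.val hx'
    have hy'' : y = (bn 0 : LinearMap.range (pairHom x y)).1 * y' := by
      simpa [hfv] using congrArg Subtype.val hy'
    have hrs' : x * r + y * s = (bn 0 : LinearMap.range (pairHom x y)).1 := by
      rw [← hrs, hfv]
    generalize (bn 0 : LinearMap.range (pairHom x y)).1 = d at hx'' hy'' hrs'
    refine ⟨d, x', y', r, s, hx'', hy'', ?_⟩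
    have hd : d ≠ 0 := by rintro rfl; simp [hx] at hx''
    apply mul_left_cancel₀ hd
    rw [mul_add, ← mul_assoc, ← mul_assoc, ← hx'', ← hy'', hrs', mul_one]
  · refine ⟨(bm 0).1.1, (bm 0).1.2, fun u v => ⟨fun h => ?_, ?_⟩⟩
    · have h1 := bm.sum_repr ⟨(u, v), (hker u v).2 h⟩
      rw [Fin.sum_univ_one] at h1
      refine ⟨(bm.repr ⟨(u, v), (hker u v).2 h⟩ 0).unop, ?_, ?_⟩
      · exact (congrArg (fun k : LinearMap.ker f => k.1.1) h1).symm
      · exact (congrArg (fun k : LinearMap.ker f => k.1.2) h1).symm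
    · rintro ⟨w, rfl, rfl⟩
      have h1 := (hker (bm 0).1.1 (bm 0).1.2).1 (bm 0).2
      rw [← mul_assoc, ← mul_assoc, ← add_mul, h1, zero_mul]

end RightIdeals

/-! ### From right to left: sums and intersections of principal left ideals. -/

section LeftIdeals

variable {R : Type u} [Ring R]

theorem mem_leftIdeal {a x : R} : x ∈ leftIdeal a ↔ ∃ r, x = r * a := by
  simp only [leftIdeal, Submodule.mem_span_singleton, smul_eq_mul, eq_comm]

theorem mul_mem_leftIdeal (r a : R) : r * a ∈ leftIdeal a := mem_leftIdeal.2 ⟨r, rfl⟩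

theorem self_mem_leftIdeal (a : R) : a ∈ leftIdeal a := Submodule.mem_span_singleton_self a

theorem leftIdeal_le {a : R} {N : Submodule R R} : leftIdeal a ≤ N ↔ a ∈ N :=
  Submodule.span_singleton_le_iff_mem a N

/-- In a 2-fir, two principal left ideals with nonzero intersection have principal sum and
intersection. -/
theorem IsTwoFir.exists_sup_inf (hR : IsTwoFir R) {a b c : R} (hc : c ≠ 0) (ha : c ∈ leftIdeal a)
    (hb : c ∈ leftIdeal b) :
    (∃ t, leftIdeal a ⊔ leftIdeal b = leftIdeal t) ∧
      ∃ m, leftIdeal a ⊓ leftIdeal b = leftIdeal m := by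
  have := hR.isDomain
  obtain ⟨x, rfl⟩ := mem_leftIdeal.1 ha
  obtain ⟨y, hy⟩ := mem_leftIdeal.1 hb
  have hrel : x * a + y * -b = 0 := by rw [hy]; simp
  obtain ⟨⟨d, x', y', r, s, rfl, rfl, hrs⟩, p, q, hpq⟩ := hR.exists_right_relations hrel hc
  have hd : d ≠ 0 := by rintro rfl; simp at hc
  have hpq' : ∀ u v, x' * u + y' * v = 0 ↔ ∃ w, u = p * w ∧ v = q * w := fun u v => by
    rw [← hpq, mul_assoc, mul_assoc, ← mul_add, mul_eq_zero, or_iff_right hd]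
  obtain ⟨t, hat, hbt⟩ := (hpq _ _).1 hrel
  have hb' : b = -(q * t) := by rw [← hbt, neg_neg]
  have ha0 : a ≠ 0 := right_ne_zero_of_mul hc
  have ht : t ≠ 0 := by rintro rfl; simp [ha0] at hat
  have hp : p ≠ 0 := by rintro rfl; simp [ha0] at hat
  have hrel' : x' * p + y' * q = 0 := (hpq' p q).2 ⟨1, by simp, by simp⟩
  -- Since `x' * r + y' * s = 1`, both columns of the matrix `1 - (r, s)ᵗ(x', y')` are relations on
  -- `(x', y')`, hence right multiples of `(p, q)ᵗ`. So this matrix equals `(p, q)ᵗ(k, l)`.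
  obtain ⟨k, hk1, hk2⟩ := (hpq' (1 - r * x') (-(s * x'))).1 (by
    calc x' * (1 - r * x') + y' * -(s * x') = x' - (x' * r + y' * s) * x' := by noncomm_ring
      _ = 0 := by rw [hrs]; simp)
  obtain ⟨l, hl1, hl2⟩ := (hpq' (-(r * y')) (1 - s * y')).1 (by
    calc x' * -(r * y') + y' * (1 - s * y') = y' - (x' * r + y' * s) * y' := by noncomm_ring
      _ = 0 := by rw [hrs]; simp)
  have hkl : k * p + l * q = 1 := by
    apply mul_left_cancel₀ hp
    calc p * (k * p + l * q) = (p * k) * p + (p * l) * q := by noncomm_ring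
      _ = (1 - r * x') * p + (-(r * y')) * q := by rw [hk1, hl1]
      _ = p - r * (x' * p + y' * q) := by noncomm_ring
      _ = p * 1 := by rw [hrel']; simp
  refine ⟨⟨t, le_antisymm (sup_le ?_ ?_) ?_⟩, x' * a, le_antisymm ?_ (le_inf ?_ ?_)⟩
  · rw [leftIdeal_le, hat]; exact mul_mem_leftIdeal _ _
  · rw [leftIdeal_le, hb', ← neg_mul]; exact mul_mem_leftIdeal _ _
  · rw [leftIdeal_le]
    have : t = k * a + (-l) * b := by
      rw [hat, hb']
      calc t = (k * p + l * q) * t := by rw [hkl, one_mul]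
        _ = _ := by noncomm_ring
    rw [this]
    exact Submodule.add_mem_sup (mul_mem_leftIdeal _ _) (mul_mem_leftIdeal _ _)
  · rintro z ⟨hz1, hz2⟩
    obtain ⟨u, rfl⟩ := mem_leftIdeal.1 hz1
    obtain ⟨v, hv⟩ := mem_leftIdeal.1 hz2
    have h1 : u * p + v * q = 0 := by
      have : (u * p + v * q) * t = 0 := by
        rw [add_mul, mul_assoc, mul_assoc, ← hat, ← hbt, hv]; simp
      exact (mul_eq_zero.1 this).resolve_right ht
    -- Multiply the matrix identity by the row `(u, v)`, which kills `(p, q)ᵗ`: the row is a left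
    -- multiple of `(x', y')`.
    have h2 : u = (u * r + v * s) * x' := by
      have : u * (1 - r * x') + v * -(s * x') = 0 := by
        rw [hk1, hk2, ← mul_assoc, ← mul_assoc, ← add_mul, h1, zero_mul]
      rw [← sub_eq_zero, ← this]
      noncomm_ring
    rw [mem_leftIdeal]
    exact ⟨u * r + v * s, by rw [← mul_assoc, ← h2]⟩
  · rw [leftIdeal_le]; exact mul_mem_leftIdeal _ _
  · rw [leftIdeal_le, mem_leftIdeal]
    refine ⟨y', ?_⟩
    rw [hat, hb', ← mul_assoc, eq_neg_of_add_eq_zero_left hrel']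
    noncomm_ring

end LeftIdeals

end TwoFir

namespace TwoFir

/-! ### Similarity and uniqueness of the length of factorizations. -/

section Factorizations

variable {R : Type u} [Ring R]

theorem leftIdeal_eq_top [IsDomain R] {a : R} : leftIdeal a = ⊤ ↔ IsUnit a := by
  constructor
  · intro h
    obtain ⟨r, hr⟩ := mem_leftIdeal.1 (h ▸ Submodule.mem_top : (1 : R) ∈ leftIdeal a)
    exact IsUnit.of_mul_eq_one_right r hr.symm
  · rintro ⟨u, rfl⟩
    rw [Submodule.eq_top_iff']
    exact fun x => mem_leftIdeal.2 ⟨x * ↑u⁻¹, by simp⟩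

theorem sup_leftIdeal_eq_top {a b : R} :
    leftIdeal a ⊔ leftIdeal b = ⊤ ↔ ∃ w v, w * a + v * b = 1 := by
  constructor
  · intro h
    obtain ⟨x, hx, y, hy, hxy⟩ :=
      Submodule.mem_sup.1 (h ▸ Submodule.mem_top : (1 : R) ∈ leftIdeal a ⊔ leftIdeal b)
    obtain ⟨w, rfl⟩ := mem_leftIdeal.1 hx
    obtain ⟨v, rfl⟩ := mem_leftIdeal.1 hy
    exact ⟨w, v, hxy⟩
  · rintro ⟨w, v, h⟩
    rw [Submodule.eq_top_iff']
    intro x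
    rw [← mul_one x, ← smul_eq_mul, ← h]
    exact Submodule.smul_mem _ _
      (Submodule.add_mem_sup (mul_mem_leftIdeal _ _) (mul_mem_leftIdeal _ _))

theorem leftIdeal_eq_of_irreducible {p t : R} (hp : Irreducible p) (ht : ¬ IsUnit t)
    (h : p ∈ leftIdeal t) : leftIdeal t = leftIdeal p := by
  obtain ⟨x, rfl⟩ := mem_leftIdeal.1 h
  obtain ⟨u, rfl⟩ := (hp.isUnit_or_isUnit rfl).resolve_right ht
  refine le_antisymm ?_ (leftIdeal_le.2 h)
  rw [leftIdeal_le, mem_leftIdeal]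
  exact ⟨↑u⁻¹, by simp⟩

/-- The left ideal of an atom is maximal among the left ideals comparable with it through a common
nonzero element. -/
theorem IsTwoFir.sup_eq_top (hR : IsTwoFir R) {p a c : R} (hp : Irreducible p) (hc : c ≠ 0)
    (hca : c ∈ leftIdeal a) (hcp : c ∈ leftIdeal p) (hap : a ∉ leftIdeal p) :
    leftIdeal a ⊔ leftIdeal p = ⊤ := by
  have := hR.isDomain
  obtain ⟨⟨t, ht⟩, -⟩ := hR.exists_sup_inf hc hca hcp
  rw [ht, leftIdeal_eq_top]
  by_contra hu
  have hpt : p ∈ leftIdeal t := ht ▸ le_sup_right (a := leftIdeal a) (self_mem_leftIdeal p)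
  apply hap
  rw [← leftIdeal_eq_of_irreducible hp hu hpt, ← ht]
  exact le_sup_left (b := leftIdeal p) (self_mem_leftIdeal a)

/-- `x ↦ xz` induces an isomorphism `R/Ra ≅ R/Rb`. -/
structure SimBy (z a b : R) : Prop where
  mem_iff : ∀ r, r ∈ leftIdeal a ↔ r * z ∈ leftIdeal b
  sup_eq_top : leftIdeal z ⊔ leftIdeal b = ⊤

/-- The inverse isomorphism is right multiplication by the Bézout coefficient `w` in `w * z + v * b
= 1`. -/
theorem SimBy.exists_symm {z a b : R} (h : SimBy z a b) : ∃ w, SimBy w b a := by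
  obtain ⟨w, v, hwv⟩ := sup_leftIdeal_eq_top.1 h.sup_eq_top
  have hwz : w * z = 1 - v * b := eq_sub_of_add_eq hwv
  refine ⟨w, fun r => ?_, ?_⟩
  · have h1 : r = r * w * z + r * v * b := by
      calc r = r * (w * z + v * b) := by rw [hwv, mul_one]
        _ = _ := by noncomm_ring
    rw [h.mem_iff]
    conv_lhs => rw [h1]
    exact Submodule.add_mem_iff_left _ (mul_mem_leftIdeal _ _)
  · have h2 : 1 - z * w ∈ leftIdeal a := by
      rw [h.mem_iff]
      have : (1 - z * w) * z = z * v * b := by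
        calc (1 - z * w) * z = z - z * (w * z) := by noncomm_ring
          _ = _ := by rw [hwz]; noncomm_ring
      rw [this]
      exact mul_mem_leftIdeal _ _
    obtain ⟨k, hk⟩ := mem_leftIdeal.1 h2
    exact sup_leftIdeal_eq_top.2 ⟨z, k, by rw [← hk]; simp⟩

theorem SimBy.of_eq {a b : R} (h : leftIdeal a = leftIdeal b) : SimBy 1 a b where
  mem_iff r := by rw [h, mul_one]
  sup_eq_top := sup_leftIdeal_eq_top.2 ⟨1, 0, by simp⟩

/-- The two ways around a parallelogram of principal left ideals. -/
theorem SimBy.parallelogram [IsDomain R] {g v w p : R} (h : SimBy g v p) (hp : p ≠ 0)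
    (hw : v * g = w * p) : SimBy p w g := by
  refine ⟨fun r => ⟨fun hr => ?_, fun hr => ?_⟩, ?_⟩
  · obtain ⟨k, rfl⟩ := mem_leftIdeal.1 hr
    rw [mul_assoc, ← hw, ← mul_assoc]
    exact mul_mem_leftIdeal _ _
  · obtain ⟨k, hk⟩ := mem_leftIdeal.1 hr
    obtain ⟨l, rfl⟩ := mem_leftIdeal.1
      ((h.mem_iff k).2 (by rw [← hk]; exact mul_mem_leftIdeal _ _))
    rw [mul_assoc, hw, ← mul_assoc] at hk
    rw [mul_right_cancel₀ hp hk]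
    exact mul_mem_leftIdeal _ _
  · rw [sup_comm]; exact h.sup_eq_top

/-- If `u * c` generates `Rc ∩ Rt`, then `Ru` is the annihilator of the class of `c` in `R/Rt`. -/
theorem IsTwoFir.exists_colon (hR : IsTwoFir R) {s c t : R} (hsc : s * c ∈ leftIdeal t)
    (h0 : s * c ≠ 0) : ∃ u, ∀ r, r ∈ leftIdeal u ↔ r * c ∈ leftIdeal t := by
  have := hR.isDomain
  obtain ⟨-, m, hm⟩ := hR.exists_sup_inf h0 (mul_mem_leftIdeal s c) hsc
  have hmm : m ∈ leftIdeal c ⊓ leftIdeal t := hm ▸ self_mem_leftIdeal m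
  obtain ⟨u, rfl⟩ := mem_leftIdeal.1 hmm.1
  have hc : c ≠ 0 := right_ne_zero_of_mul h0
  refine ⟨u, fun r => ⟨fun hr => ?_, fun hr => ?_⟩⟩
  · obtain ⟨k, rfl⟩ := mem_leftIdeal.1 hr
    rw [mul_assoc]
    exact Submodule.smul_mem _ k hmm.2
  · have h1 : r * c ∈ leftIdeal (u * c) := hm ▸ ⟨mul_mem_leftIdeal _ _, hr⟩
    obtain ⟨k, hk⟩ := mem_leftIdeal.1 h1
    rw [← mul_assoc] at hk
    rw [mul_right_cancel₀ hc hk]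
    exact mul_mem_leftIdeal _ _

/-- The annihilator of a nonzero torsion element of `R/Rt`, where `t` is an atom, is generated by
an atom similar to `t`. -/
theorem IsTwoFir.exists_irreducible_simBy (hR : IsTwoFir R) {s c t : R} (ht : Irreducible t)
    (hs : s ≠ 0) (hsc : s * c ∈ leftIdeal t) (hc : c ∉ leftIdeal t) :
    ∃ u, Irreducible u ∧ SimBy c u t := by
  have := hR.isDomain
  have hc0 : c ≠ 0 := by rintro rfl; exact hc (Submodule.zero_mem _)
  have hsc0 : s * c ≠ 0 := mul_ne_zero hs hc0
  obtain ⟨u, hu⟩ := hR.exists_colon hsc hsc0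
  have hu0 : u ≠ 0 := by
    rintro rfl
    obtain ⟨k, hk⟩ := mem_leftIdeal.1 ((hu s).2 hsc)
    exact hs (by simpa using hk)
  have huc := (hu u).1 (self_mem_leftIdeal u)
  refine ⟨u, ⟨fun h => ?_, fun x y hxy => ?_⟩, hu,
    hR.sup_eq_top ht hsc0 (mul_mem_leftIdeal _ _) hsc hc⟩
  · have h1 := (hu 1).1 ((leftIdeal_eq_top.2 h).symm ▸ Submodule.mem_top)
    rw [one_mul] at h1
    exact hc h1
  · by_cases hy : y ∈ leftIdeal u
    · left
      obtain ⟨z, hz⟩ := mem_leftIdeal.1 hy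
      have h1 : (x * z) * u = 1 * u := by rw [mul_assoc, ← hz, ← hxy, one_mul]
      exact IsUnit.of_mul_eq_one z (mul_right_cancel₀ hu0 h1)
    · right
      have hyc : y * c ∉ leftIdeal t := fun h => hy ((hu y).2 h)
      -- The class of `y * c` is a nonzero torsion element, so it generates `R/Rt`. Writing `1` as
      -- `z * (y * c)` modulo `Rt` shows that `1 - c * z * y` annihilates `c`, hence lies in `Ru ⊆
      -- Ry`, and `y` is left invertible.
      have h1 := hR.sup_eq_top ht (c := u * c) (mul_ne_zero hu0 hc0)
        (by rw [hxy, mul_assoc]; exact mul_mem_leftIdeal _ _) huc hyc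
      obtain ⟨z, w, hzw⟩ := sup_leftIdeal_eq_top.1 h1
      have h2 : 1 - c * z * y ∈ leftIdeal u := by
        rw [hu]
        have : (1 - c * z * y) * c = c * w * t := by
          calc (1 - c * z * y) * c = c * (z * (y * c) + w * t) - c * z * y * c := by
                rw [hzw]; noncomm_ring
            _ = _ := by noncomm_ring
        rw [this]
        exact mul_mem_leftIdeal _ _
      obtain ⟨k, hk⟩ := mem_leftIdeal.1 h2
      refine IsUnit.of_mul_eq_one_right (c * z + k * x) ?_
      calc (c * z + k * x) * y = c * z * y + k * (x * y) := by noncomm_ring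
        _ = 1 := by rw [← hxy, ← hk]; simp

theorem IsProductOfAtoms.isUnit {a : R} (h : IsProductOfAtoms a 0) : IsUnit a := by
  obtain h | ⟨l, hl, -, rfl⟩ := h
  · exact h.1
  · rw [List.length_eq_zero_iff] at hl
    simp [hl]

theorem IsProductOfAtoms.ne_zero [IsDomain R] {a : R} {n : ℕ} (h : IsProductOfAtoms a n) :
    a ≠ 0 := by
  obtain h | ⟨l, -, hl, rfl⟩ := h
  · exact h.1.ne_zero
  · exact List.prod_ne_zero fun h0 => (hl 0 h0).ne_zero rfl

theorem isProductOfAtoms_zero {a : R} (h : IsUnit a) : IsProductOfAtoms a 0 := .inl ⟨h, rfl⟩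

theorem isProductOfAtoms_one {a : R} (h : Irreducible a) : IsProductOfAtoms a 1 :=
  .inr ⟨[a], by simp, by simp [h], by simp⟩

theorem IsProductOfAtoms.mul_atom {a p : R} {n : ℕ} (h : IsProductOfAtoms a n)
    (hp : Irreducible p) : IsProductOfAtoms (a * p) (n + 1) := by
  obtain ⟨h, rfl⟩ | ⟨l, rfl, hl, rfl⟩ := h
  · exact isProductOfAtoms_one ((irreducible_isUnit_mul h).2 hp)
  · refine .inr ⟨l ++ [p], by simp, fun q hq => ?_, by simp⟩
    rcases List.mem_append.1 hq with h | h
    · exact hl q h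
    · rw [List.mem_singleton.1 h]; exact hp

theorem IsProductOfAtoms.atom_mul {a p : R} {n : ℕ} (h : IsProductOfAtoms a n)
    (hp : Irreducible p) : IsProductOfAtoms (p * a) (n + 1) := by
  obtain ⟨h, rfl⟩ | ⟨l, rfl, hl, rfl⟩ := h
  · exact isProductOfAtoms_one ((irreducible_mul_isUnit h).2 hp)
  · refine .inr ⟨p :: l, by simp, fun q hq => ?_, by simp⟩
    rcases List.mem_cons.1 hq with rfl | h
    · exact hp
    · exact hl q h

theorem IsProductOfAtoms.exists_mul_atom {a : R} {n : ℕ} (h : IsProductOfAtoms a (n + 1)) :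
    ∃ a' p, a = a' * p ∧ IsProductOfAtoms a' n ∧ Irreducible p := by
  obtain ⟨-, h⟩ | ⟨l, hn, hl, rfl⟩ := h
  · cases h
  · obtain rfl | ⟨l', p, rfl⟩ := List.eq_nil_or_concat l
    · simp at hn
    · refine ⟨l'.prod, p, by simp, .inr ⟨l', by simpa using hn, fun q hq => hl q ?_, rfl⟩,
        hl p ?_⟩ <;> simp [*]

theorem IsProductOfAtoms.exists_atom_mul {a : R} {n : ℕ} (h : IsProductOfAtoms a (n + 1)) :
    ∃ p a', a = p * a' ∧ IsProductOfAtoms a' n ∧ Irreducible p := by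
  obtain ⟨-, h⟩ | ⟨l, hn, hl, rfl⟩ := h
  · cases h
  · obtain _ | ⟨p, l'⟩ := l
    · simp at hn
    · refine ⟨p, l'.prod, by simp, .inr ⟨l', by simpa using hn, fun q hq => hl q ?_, rfl⟩,
        hl p ?_⟩ <;> simp [*]

/-- One atom is peeled off on the right. Write the second element as `b * p`. The annihilator of `z`
modulo `Rp` is `Rt` for an atom `t`, and `a = a' * t`. The isomorphism carries `Rt/Ra` onto
`Rp/Rbp`, which makes `a'` similar to `b`. -/
theorem SimBy.isProductOfAtoms (hR : IsTwoFir R) {n : ℕ} {b : R} (hb : IsProductOfAtoms b n)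
    {z a : R} (ha : a ≠ 0) (h : SimBy z a b) : IsProductOfAtoms a n := by
  have := hR.isDomain
  induction n generalizing a b z with
  | zero =>
    refine isProductOfAtoms_zero (leftIdeal_eq_top.1 ?_)
    rw [Submodule.eq_top_iff']
    intro r
    rw [h.mem_iff, leftIdeal_eq_top.2 hb.isUnit]
    exact Submodule.mem_top
  | succ n ih =>
    obtain ⟨b, p, rfl, hb, hp⟩ := hb.exists_mul_atom
    obtain ⟨k, hk⟩ := mem_leftIdeal.1 ((h.mem_iff a).1 (self_mem_leftIdeal a))
    obtain ⟨w, v, hwv⟩ := sup_leftIdeal_eq_top.1 h.sup_eq_top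
    have hzp : z ∉ leftIdeal p := fun hz => by
      obtain ⟨y, rfl⟩ := mem_leftIdeal.1 hz
      refine hp.not_isUnit (IsUnit.of_mul_eq_one_right (w * y + v * b) ?_)
      rw [← hwv]; noncomm_ring
    obtain ⟨t, ht, htz⟩ := hR.exists_irreducible_simBy hp ha
      (by rw [hk, ← mul_assoc]; exact mul_mem_leftIdeal _ _) hzp
    obtain ⟨a', rfl⟩ := mem_leftIdeal.1 ((htz.mem_iff a).2
      (by rw [hk, ← mul_assoc]; exact mul_mem_leftIdeal _ _))
    obtain ⟨c', hc'⟩ := mem_leftIdeal.1 ((htz.mem_iff t).1 (self_mem_leftIdeal t))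
    have hcancel : ∀ {x y q : R}, q ≠ 0 → (x * q ∈ leftIdeal (y * q) ↔ x ∈ leftIdeal y) := by
      intro x y q hq
      simp only [mem_leftIdeal]
      refine exists_congr fun r => ?_
      rw [← mul_assoc, mul_left_inj' hq]
    refine (ih hb (left_ne_zero_of_mul ha) (z := c') ⟨fun r => ?_, ?_⟩).mul_atom ht
    · rw [← hcancel ht.ne_zero, h.mem_iff, mul_assoc, hc', ← mul_assoc, hcancel hp.ne_zero]
    · have h1 : p * (w * z) ∈ leftIdeal p := by
        have : p * (w * z) = (1 - p * v * b) * p := by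
          calc p * (w * z) = p * (w * z + v * (b * p)) - p * v * b * p := by noncomm_ring
            _ = _ := by rw [hwv]; noncomm_ring
        rw [this]
        exact mul_mem_leftIdeal _ _
      rw [← mul_assoc, ← htz.mem_iff] at h1
      obtain ⟨z', hz'⟩ := mem_leftIdeal.1 h1
      refine sup_leftIdeal_eq_top.2 ⟨z', p * v, mul_right_cancel₀ hp.ne_zero ?_⟩
      calc (z' * c' + p * v * b) * p = z' * (c' * p) + p * v * b * p := by noncomm_ring
        _ = (z' * t) * z + p * v * b * p := by rw [← hc']; noncomm_ring
        _ = p * (w * z + v * (b * p)) := by rw [← hz']; noncomm_ring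
        _ = 1 * p := by rw [hwv]; simp

/-- Factors of a product of `n` atoms are products of atoms, of complementary lengths. -/
theorem IsProductOfAtoms.exists_of_mul (hR : IsTwoFir R) {n : ℕ} {x g : R}
    (h : IsProductOfAtoms (x * g) n) :
    ∃ i j, IsProductOfAtoms x i ∧ IsProductOfAtoms g j ∧ i + j = n := by
  have := hR.isDomain
  induction n generalizing x g with
  | zero =>
    obtain ⟨hx, hg⟩ := IsUnit.mul_iff.1 h.isUnit
    exact ⟨0, 0, isProductOfAtoms_zero hx, isProductOfAtoms_zero hg, rfl⟩
  | succ n ih =>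
    have hxg := h.ne_zero
    obtain ⟨f', p, hf, hf', hp⟩ := h.exists_mul_atom
    by_cases hg : g ∈ leftIdeal p
    · obtain ⟨g', rfl⟩ := mem_leftIdeal.1 hg
      rw [← mul_assoc] at hf
      rw [← mul_right_cancel₀ hp.ne_zero hf] at hf'
      obtain ⟨i, j, hi, hj, rfl⟩ := ih hf'
      exact ⟨i, j + 1, hi, hj.mul_atom hp, rfl⟩
    · have hxgp : x * g ∈ leftIdeal p := hf ▸ mul_mem_leftIdeal _ _
      obtain ⟨v, hv, hvg⟩ := hR.exists_irreducible_simBy hp (left_ne_zero_of_mul hxg) hxgp hg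
      obtain ⟨y, rfl⟩ := mem_leftIdeal.1 ((hvg.mem_iff x).2 hxgp)
      obtain ⟨w, hw⟩ := mem_leftIdeal.1 ((hvg.mem_iff v).1 (self_mem_leftIdeal v))
      have hf'' : f' = y * w := by
        apply mul_right_cancel₀ hp.ne_zero
        rw [← hf, mul_assoc, hw, mul_assoc]
      obtain ⟨i, j, hi, hj, rfl⟩ := ih (hf'' ▸ hf')
      obtain ⟨z, hz⟩ := (hvg.parallelogram hp.ne_zero hw).exists_symm
      exact ⟨i + 1, j, hi.mul_atom hv, hz.isProductOfAtoms hR hj (right_ne_zero_of_mul hxg),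
        by omega⟩

theorem IsProductOfAtoms.eq_one [IsDomain R] {p : R} (hp : Irreducible p) {n : ℕ} (h : IsProductOfAtoms p n) :
    n = 1 := by
  match n with
  | 0 => exact absurd h.isUnit hp.not_isUnit
  | 1 => rfl
  | n + 2 =>
    obtain ⟨a, q, rfl, ha, hq⟩ := h.exists_mul_atom
    obtain ⟨b, q', rfl, hb, hq'⟩ := ha.exists_mul_atom
    rcases hp.isUnit_or_isUnit rfl with h | h
    · exact absurd (IsUnit.mul_iff.1 h).2 hq'.not_isUnit
    · exact absurd h hq.not_isUnit

/-- Splitting off the last atom of one factorization, additivity of lengths applied to the other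
factorization allows induction. -/
theorem IsProductOfAtoms.unique (hR : IsTwoFir R) {a : R} {n m : ℕ} (h : IsProductOfAtoms a n)
    (h' : IsProductOfAtoms a m) : n = m := by
  have := hR.isDomain
  induction m generalizing a n with
  | zero =>
    match n with
    | 0 => rfl
    | n + 1 =>
      obtain ⟨b, q, rfl, hb, hq⟩ := h.exists_mul_atom
      exact absurd (IsUnit.mul_iff.1 h'.isUnit).2 hq.not_isUnit
  | succ m ih =>
    obtain ⟨b, q, rfl, hb, hq⟩ := h'.exists_mul_atom
    obtain ⟨i, j, hi, hj, rfl⟩ := h.exists_of_mul hR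
    rw [ih hi hb, hj.eq_one hq]

theorem len_eq (hR : IsTwoFir R) {a : R} {n : ℕ} (h : IsProductOfAtoms a n) : len a = n :=
  le_antisymm (iInf₂_le n h) (le_iInf₂ fun m hm => by rw [h.unique hR hm])

theorem mem_finLen {a : R} : a ∈ finLen R ↔ ∃ n, IsProductOfAtoms a n := by
  simp only [finLen, len, Set.mem_ofPred_eq, iInf_lt_iff]
  exact ⟨fun ⟨n, h, _⟩ => ⟨n, h⟩, fun ⟨n, h⟩ => ⟨n, h, ENat.natCast_lt_top n⟩⟩

end Factorizations

end TwoFir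

namespace TwoFir

/-! ### `F`-bases as irredundant intersections of atoms. -/

section Bases

variable {R : Type u} [Ring R]

theorem mem_iInf_leftIdeal {Γ : Finset R} {x : R} :
    x ∈ (⨅ γ ∈ Γ, leftIdeal γ) ↔ ∀ γ ∈ Γ, x ∈ leftIdeal γ := by
  simp only [Submodule.mem_iInf]

theorem IsProductOfAtoms.le_of_mem (hR : IsTwoFir R) {f m : R} {n k : ℕ}
    (hf : IsProductOfAtoms f n) (hm : IsProductOfAtoms m k) (h : f ∈ leftIdeal m) : k ≤ n := by
  obtain ⟨x, rfl⟩ := mem_leftIdeal.1 h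
  obtain ⟨i, j, -, hj, rfl⟩ := hf.exists_of_mul hR
  rw [hm.unique hR hj]
  omega

/-- The annihilator of `m` in `R/Rp` is `Rv` for an atom `v`, so `Rp ∩ Rm = Rvm`: the length grows
by exactly one. -/
theorem IsTwoFir.exists_inf_atom (hR : IsTwoFir R) {f m p : R} (hf : f ≠ 0)
    (hfm : f ∈ leftIdeal m) (hp : p ∈ V f) (hmp : m ∉ leftIdeal p) {k : ℕ}
    (hm : IsProductOfAtoms m k) :
    ∃ m', leftIdeal p ⊓ leftIdeal m = leftIdeal m' ∧ IsProductOfAtoms m' (k + 1) := by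
  obtain ⟨s, rfl⟩ := mem_leftIdeal.1 hfm
  obtain ⟨v, hv, hvm⟩ := hR.exists_irreducible_simBy hp.1 (left_ne_zero_of_mul hf) hp.2 hmp
  refine ⟨v * m, ?_, hm.atom_mul hv⟩
  ext x
  constructor
  · rintro ⟨h1, h2⟩
    obtain ⟨r, rfl⟩ := mem_leftIdeal.1 h2
    obtain ⟨l, rfl⟩ := mem_leftIdeal.1 ((hvm.mem_iff r).2 h1)
    rw [mul_assoc]
    exact mul_mem_leftIdeal _ _
  · intro h
    obtain ⟨l, rfl⟩ := mem_leftIdeal.1 h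
    refine ⟨?_, by rw [← mul_assoc]; exact mul_mem_leftIdeal _ _⟩
    exact Submodule.smul_mem _ l ((hvm.mem_iff v).1 (self_mem_leftIdeal v))

theorem iInf_empty_leftIdeal : (⨅ γ ∈ (∅ : Finset R), leftIdeal γ) = leftIdeal (1 : R) := by
  rw [eq_comm]
  simp

theorem IsTwoFir.exists_iInf_eq (hR : IsTwoFir R) {f : R} (hf : f ≠ 0) (Γ : Finset R)
    (hΓ : ∀ γ ∈ Γ, γ ∈ V f) :
    ∃ m k, (⨅ γ ∈ Γ, leftIdeal γ) = leftIdeal m ∧ IsProductOfAtoms m k ∧ k ≤ Γ.card := by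
  classical
  induction Γ using Finset.induction_on with
  | empty => exact ⟨1, 0, iInf_empty_leftIdeal, isProductOfAtoms_zero isUnit_one, le_rfl⟩
  | insert a s has ih =>
    obtain ⟨m, k, hm, hk, hks⟩ := ih fun γ h => hΓ γ (Finset.mem_insert_of_mem h)
    rw [Finset.iInf_insert, hm, Finset.card_insert_of_notMem has]
    have hfm : f ∈ leftIdeal m := by
      rw [← hm, mem_iInf_leftIdeal]
      exact fun γ h => (hΓ γ (Finset.mem_insert_of_mem h)).2
    by_cases ham : m ∈ leftIdeal a
    · exact ⟨m, k, inf_eq_right.2 (leftIdeal_le.2 ham), hk, by omega⟩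
    · obtain ⟨m', h1, h2⟩ := hR.exists_inf_atom hf hfm (hΓ a (Finset.mem_insert_self a s)) ham hk
      exact ⟨m', k + 1, h1, h2, by omega⟩

theorem IsTwoFir.exists_iInf_eq_of_indep (hR : IsTwoFir R) {f : R} (hf : f ≠ 0) [DecidableEq R]
    (Γ : Finset R) (hΓ : ∀ γ ∈ Γ, γ ∈ V f)
    (hi : ∀ γ ∈ Γ, ¬ (⨅ x ∈ Γ.erase γ, leftIdeal x) ≤ leftIdeal γ) :
    ∃ m, (⨅ γ ∈ Γ, leftIdeal γ) = leftIdeal m ∧ IsProductOfAtoms m Γ.card := by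
  induction Γ using Finset.induction_on with
  | empty => exact ⟨1, iInf_empty_leftIdeal, isProductOfAtoms_zero isUnit_one⟩
  | insert a s has ih =>
    obtain ⟨m, hm, hk⟩ := ih (fun γ h => hΓ γ (Finset.mem_insert_of_mem h)) fun γ h h' =>
      hi γ (Finset.mem_insert_of_mem h)
        ((biInf_mono fun x hx => Finset.erase_subset_erase _ (Finset.subset_insert a s) hx).trans
          h')
    rw [Finset.iInf_insert, hm, Finset.card_insert_of_notMem has]
    have hfm : f ∈ leftIdeal m := by
      rw [← hm, mem_iInf_leftIdeal]
      exact fun γ h => (hΓ γ (Finset.mem_insert_of_mem h)).2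
    refine hR.exists_inf_atom hf hfm (hΓ a (Finset.mem_insert_self a s)) (fun h => ?_) hk
    have := hi a (Finset.mem_insert_self a s)
    rw [Finset.erase_insert has, hm, leftIdeal_le] at this
    exact this h

/-- A finite set `Γ` of atoms with irredundant intersection `Rm = ⋂_{p ∈ V(f)} Rp`. -/
structure IsMeetBasis (f : R) (Γ : Finset R) (m : R) : Prop where
  mem_V : ∀ γ ∈ Γ, γ ∈ V f
  iInf_eq : (⨅ γ ∈ Γ, leftIdeal γ) = leftIdeal m
  prod : IsProductOfAtoms m Γ.card
  mem_of_V : ∀ p ∈ V f, m ∈ leftIdeal p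

theorem IsMeetBasis.mem {f m : R} {Γ : Finset R} (h : IsMeetBasis f Γ m) : f ∈ leftIdeal m := by
  rw [← h.iInf_eq, mem_iInf_leftIdeal]
  exact fun γ hγ => (h.mem_V γ hγ).2

theorem IsMeetBasis.mem_iff {f m : R} {Γ : Finset R} (h : IsMeetBasis f Γ m) {x : R} :
    x ∈ leftIdeal m ↔ ∀ p ∈ V f, x ∈ leftIdeal p := by
  refine ⟨fun hx p hp => leftIdeal_le.2 (h.mem_of_V p hp) hx, fun hx => ?_⟩
  rw [← h.iInf_eq, mem_iInf_leftIdeal]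
  exact fun γ hγ => hx γ (h.mem_V γ hγ)

theorem IsProductOfAtoms.congr (hR : IsTwoFir R) {a b : R} {n : ℕ} (hb : IsProductOfAtoms b n)
    (h : leftIdeal a = leftIdeal b) : IsProductOfAtoms a n := by
  have := hR.isDomain
  refine (SimBy.of_eq h).isProductOfAtoms hR hb ?_
  rintro rfl
  obtain ⟨r, hr⟩ := mem_leftIdeal.1 (h ▸ self_mem_leftIdeal b)
  exact hb.ne_zero (by simpa using hr)

theorem IsMeetBasis.card_eq (hR : IsTwoFir R) {f m m' : R} {Γ Γ' : Finset R}
    (h : IsMeetBasis f Γ m) (h' : IsMeetBasis f Γ' m') : Γ.card = Γ'.card := by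
  have : leftIdeal m = leftIdeal m' := by
    ext x
    rw [h.mem_iff, h'.mem_iff]
  exact (h.prod.unique hR (h'.prod.congr hR this))

/-- Otherwise atoms of `V(f)` could be adjoined forever, each raising the length of the intersection
by one, although that length is bounded by `ℓ(f)`. -/
theorem IsTwoFir.exists_isMeetBasis (hR : IsTwoFir R) {f : R} {n : ℕ}
    (hf : IsProductOfAtoms f n) : ∃ Γ m, IsMeetBasis f Γ m := by
  classical
  have := hR.isDomain
  by_contra! hcon
  have key : ∀ k, ∃ Γ : Finset R, Γ.card = k ∧ (∀ γ ∈ Γ, γ ∈ V f) ∧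
      ∃ m, (⨅ γ ∈ Γ, leftIdeal γ) = leftIdeal m ∧ IsProductOfAtoms m Γ.card := by
    intro k
    induction k with
    | zero =>
      exact ⟨∅, rfl, by simp, 1, iInf_empty_leftIdeal, isProductOfAtoms_zero isUnit_one⟩
    | succ k ih =>
      obtain ⟨Γ, hk, hV, m, hm, hprod⟩ := ih
      have hfm : f ∈ leftIdeal m := by
        rw [← hm, mem_iInf_leftIdeal]
        exact fun γ h => (hV γ h).2
      have : ∃ p ∈ V f, m ∉ leftIdeal p := by
        by_contra! h
        exact hcon Γ m ⟨hV, hm, hprod, h⟩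
      obtain ⟨p, hp, hmp⟩ := this
      have hpΓ : p ∉ Γ := fun h => hmp
        (mem_iInf_leftIdeal.1 (hm ▸ self_mem_leftIdeal m) p h)
      refine ⟨insert p Γ, by rw [Finset.card_insert_of_notMem hpΓ, hk], ?_, ?_⟩
      · intro γ hγ
        rcases Finset.mem_insert.1 hγ with rfl | h
        · exact hp
        · exact hV γ h
      · rw [Finset.card_insert_of_notMem hpΓ, Finset.iInf_insert, hm]
        exact hR.exists_inf_atom hf.ne_zero hfm hp hmp hprod
  obtain ⟨Γ, hk, hV, m, hm, hprod⟩ := key (n + 1)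
  have := hf.le_of_mem hR hprod (by
    rw [← hm, mem_iInf_leftIdeal]
    exact fun γ h => (hV γ h).2)
  omega

theorem isFAlgebraic_of_subset [IsDomain R] {f : R} (hf : f ≠ 0) {Δ : Set R} (h : Δ ⊆ V f) :
    IsFAlgebraic Δ := by
  refine ⟨fun δ hδ => ⟨mem_finLen.2 ⟨1, isProductOfAtoms_one (h hδ).1⟩, (h hδ).1.not_isUnit⟩, ?_⟩
  rw [Submodule.ne_bot_iff]
  refine ⟨f, ?_, hf⟩
  simp only [Submodule.mem_iInf]
  exact fun δ hδ => (h hδ).2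

/-- A finite intersection from `Δ` is some `Rm` containing `f ≠ 0`. Since `d` is an atom, `Rd + Rm`
is either `Rd` or `R`, so dependence becomes an inclusion of left ideals. -/
theorem IsTwoFir.isFDependent_iff (hR : IsTwoFir R) {f d : R} (hf : f ≠ 0) {Δ : Set R}
    (h : Δ ⊆ V f) (hd : d ∈ V f) :
    IsFDependent d Δ ↔
      ∃ Γ : Finset R, (Γ : Set R) ⊆ Δ ∧ (⨅ γ ∈ Γ, leftIdeal γ) ≤ leftIdeal d := by
  have := hR.isDomain
  have hΔ : Δ ∪ {d} ⊆ V f := Set.union_subset h (Set.singleton_subset_iff.2 hd)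
  refine ⟨fun ⟨_, Γ, hΓ, hne⟩ => ⟨Γ, hΓ, ?_⟩,
    fun ⟨Γ, hΓ, hle⟩ => ⟨isFAlgebraic_of_subset hf hΔ, Γ, hΓ, ?_⟩⟩
  · obtain ⟨m, k, hm, -⟩ := hR.exists_iInf_eq hf Γ fun γ hγ => h (hΓ hγ)
    rw [hm] at hne ⊢
    rw [leftIdeal_le]
    by_contra hmd
    apply hne
    rw [sup_comm]
    refine hR.sup_eq_top hd.1 hf ?_ hd.2 hmd
    rw [← hm, mem_iInf_leftIdeal]
    exact fun γ hγ => (h (hΓ hγ)).2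
  · rw [sup_eq_left.2 hle, ne_eq, leftIdeal_eq_top]
    exact hd.1.not_isUnit

/-- If `γ` were redundant, `m` would have length at most `|Γ| - 1`. -/
theorem IsMeetBasis.not_le (hR : IsTwoFir R) {f m : R} (hf : f ≠ 0) {Γ : Finset R}
    (h : IsMeetBasis f Γ m) [DecidableEq R] {γ : R} (hγ : γ ∈ Γ) :
    ¬ (⨅ x ∈ Γ.erase γ, leftIdeal x) ≤ leftIdeal γ := by
  intro hle
  obtain ⟨m', k, hm', hk, hkc⟩ := hR.exists_iInf_eq hf (Γ.erase γ)
    fun x hx => h.mem_V x (Finset.mem_of_mem_erase hx)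
  have h1 : leftIdeal m = leftIdeal m' := by
    rw [← hm', ← h.iInf_eq]
    conv_lhs => rw [← Finset.insert_erase hγ]
    rw [Finset.iInf_insert]
    exact inf_eq_right.2 hle
  have h2 := h.prod.unique hR (hk.congr hR h1)
  have h3 := Finset.card_erase_lt_of_mem hγ
  omega

theorem IsMeetBasis.isFBasis (hR : IsTwoFir R) {f m : R} (hf : f ≠ 0) {Γ : Finset R}
    (h : IsMeetBasis f Γ m) : IsFBasis (Γ : Set R) (V f) := by
  classical
  have := hR.isDomain
  have hΓ : (Γ : Set R) ⊆ V f := fun γ hγ => h.mem_V γ hγ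
  refine ⟨hΓ, ⟨isFAlgebraic_of_subset hf hΓ, fun δ hδ => ?_⟩, fun d hd => ?_⟩
  · rw [hR.isFDependent_iff hf (Set.sdiff_subset.trans hΓ) (hΓ hδ)]
    rintro ⟨Γ', hΓ', hle⟩
    refine h.not_le hR hf hδ ((biInf_mono fun x hx => ?_).trans hle)
    have := hΓ' hx
    exact Finset.mem_erase.2 ⟨this.2, this.1⟩
  · rw [hR.isFDependent_iff hf hΓ hd]
    exact ⟨Γ, subset_rfl, by rw [h.iInf_eq, leftIdeal_le]; exact h.mem_of_V d hd⟩

theorem IsFBasis.exists_isMeetBasis (hR : IsTwoFir R) {f : R} {n : ℕ}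
    (hf : IsProductOfAtoms f n) {B : Set R} (hB : IsFBasis B (V f)) :
    ∃ Γ : Finset R, (Γ : Set R) = B ∧ ∃ m, IsMeetBasis f Γ m := by
  classical
  have := hR.isDomain
  have hf0 := hf.ne_zero
  have hfin : ∀ Γ : Finset R, (Γ : Set R) ⊆ B →
      ∃ m, (⨅ γ ∈ Γ, leftIdeal γ) = leftIdeal m ∧ IsProductOfAtoms m Γ.card := fun Γ hΓ => by
    refine hR.exists_iInf_eq_of_indep hf0 Γ (fun γ hγ => hB.1 (hΓ hγ)) fun γ hγ hle => ?_
    refine hB.2.1.2 γ (hΓ hγ) ?_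
    rw [hR.isFDependent_iff hf0 (Set.sdiff_subset.trans hB.1) (hB.1 (hΓ hγ))]
    refine ⟨Γ.erase γ, fun x hx => ?_, hle⟩
    have := Finset.mem_erase.1 hx
    exact ⟨hΓ this.2, this.1⟩
  -- A subset of `B` with `n + 1` elements would intersect in `Rm` with `ℓ(m) = n + 1`, although `m`
  -- is a right factor of `f`.
  have hBfin : B.Finite := by
    by_contra hinf
    obtain ⟨Γ, hΓ, hc⟩ := Set.Infinite.exists_subset_card_eq hinf (n + 1)
    obtain ⟨m, hm, hp⟩ := hfin Γ hΓ
    have := hf.le_of_mem hR hp (by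
      rw [← hm, mem_iInf_leftIdeal]
      exact fun γ h => (hB.1 (hΓ h)).2)
    omega
  obtain ⟨Γ, rfl⟩ := hBfin.exists_finset_coe
  obtain ⟨m, hm, hp⟩ := hfin Γ subset_rfl
  refine ⟨Γ, rfl, m, fun γ hγ => hB.1 hγ, hm, hp, fun p hpV => ?_⟩
  obtain ⟨Γ', hΓ', hle⟩ := (hR.isFDependent_iff hf0 hB.1 hpV).1 (hB.2.2 p hpV)
  apply hle
  rw [mem_iInf_leftIdeal]
  exact fun γ hγ => mem_iInf_leftIdeal.1 (hm ▸ self_mem_leftIdeal m) γ (hΓ' hγ)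

theorem IsMeetBasis.encard_eq (hR : IsTwoFir R) {f m : R} {n : ℕ} (hf : IsProductOfAtoms f n)
    {Γ : Finset R} (h : IsMeetBasis f Γ m) {B : Set R} (hB : IsFBasis B (V f)) :
    B.encard = Γ.card := by
  obtain ⟨Γ', rfl, m', h'⟩ := hB.exists_isMeetBasis hR hf
  rw [Set.encard_coe_eq_coe_finsetCard, h'.card_eq hR h]

theorem IsMeetBasis.rk_eq (hR : IsTwoFir R) {f m : R} {n : ℕ} (hf : IsProductOfAtoms f n)
    {Γ : Finset R} (h : IsMeetBasis f Γ m) : rk (V f) = Γ.card := by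
  have := hR.isDomain
  have hB := h.isFBasis hR hf.ne_zero
  exact le_antisymm ((iInf₂_le (f := fun B (_ : IsFBasis B (V f)) => B.encard) _ hB).trans_eq (h.encard_eq hR hf hB))
    (le_iInf₂ fun B hB => (h.encard_eq hR hf hB).ge)

/-- Elements of the basis are separated by elements of the ring. -/
theorem IsMeetBasis.exists_separating (hR : IsTwoFir R) {f m : R} (hf : f ≠ 0) {Γ : Finset R}
    (h : IsMeetBasis f Γ m) :
    ∃ e : R → R, (∀ γ ∈ Γ, ∀ x ∈ Γ, x ≠ γ → e γ ∈ leftIdeal x) ∧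
      (∀ γ ∈ Γ, 1 - e γ ∈ leftIdeal γ) := by
  classical
  have key : ∀ γ ∈ Γ, ∃ e : R, (∀ x ∈ Γ, x ≠ γ → e ∈ leftIdeal x) ∧ 1 - e ∈ leftIdeal γ := by
    intro γ hγ
    obtain ⟨m', k, hm', -⟩ := hR.exists_iInf_eq hf (Γ.erase γ)
      fun x hx => h.mem_V x (Finset.mem_of_mem_erase hx)
    have h1 := h.not_le hR hf hγ
    rw [hm', leftIdeal_le] at h1
    have h2 := hR.sup_eq_top (h.mem_V γ hγ).1 hf (by
      rw [← hm', mem_iInf_leftIdeal]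
      exact fun x hx => (h.mem_V x (Finset.mem_of_mem_erase hx)).2) (h.mem_V γ hγ).2 h1
    obtain ⟨w, v, hwv⟩ := sup_leftIdeal_eq_top.1 h2
    refine ⟨w * m', fun x hx hxγ => ?_, ?_⟩
    · have h3 : w * m' ∈ leftIdeal m' := mul_mem_leftIdeal _ _
      rw [← hm', mem_iInf_leftIdeal] at h3
      exact h3 x (Finset.mem_erase.2 ⟨hxγ, hx⟩)
    · rw [← hwv, add_sub_cancel_left]
      exact mul_mem_leftIdeal _ _
  choose! e he using key
  exact ⟨e, fun γ hγ => (he γ hγ).1, fun γ hγ => (he γ hγ).2⟩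

/-- Modulo `Rm`, the elements `e γ` are the components of 1 in the decomposition `R/Rm ≅ ⨁ R/Rγ`.
Together with `IsMeetBasis.mul_separating`, this lets the decomposition be used through elements. -/
theorem IsMeetBasis.sum_separating {f m : R} {Γ : Finset R} (h : IsMeetBasis f Γ m) {e : R → R}
    (he : ∀ γ ∈ Γ, ∀ x ∈ Γ, x ≠ γ → e γ ∈ leftIdeal x) (he' : ∀ γ ∈ Γ, 1 - e γ ∈ leftIdeal γ) :
    1 - ∑ γ ∈ Γ, e γ ∈ leftIdeal m := by
  classical
  rw [← h.iInf_eq, mem_iInf_leftIdeal]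
  intro γ hγ
  rw [← Finset.add_sum_erase Γ e hγ, ← sub_sub]
  refine Submodule.sub_mem _ (he' γ hγ) (Submodule.sum_mem _ fun x hx => ?_)
  have := Finset.mem_erase.1 hx
  exact he x this.2 γ hγ this.1.symm

theorem IsMeetBasis.mul_separating {f m : R} {Γ : Finset R} (h : IsMeetBasis f Γ m) {e : R → R}
    (he : ∀ γ ∈ Γ, ∀ x ∈ Γ, x ≠ γ → e γ ∈ leftIdeal x) (he' : ∀ γ ∈ Γ, 1 - e γ ∈ leftIdeal γ)
    {γ r : R} (hγ : γ ∈ Γ) (hr : r ∈ leftIdeal γ) : r * e γ ∈ leftIdeal m := by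
  rw [← h.iInf_eq, mem_iInf_leftIdeal]
  intro x hx
  by_cases hxγ : x = γ
  · subst hxγ
    have : r * e x = r - r * (1 - e x) := by noncomm_ring
    rw [this]
    exact Submodule.sub_mem _ hr (Submodule.smul_mem _ r (he' x hx))
  · exact Submodule.smul_mem _ r (he γ hγ x hx hxγ)

end Bases

end TwoFir

namespace TwoFir

/-! ### Endomorphism rings, similarity classes and the dimension of the kernel. -/

section Modules

variable {R : Type u} [Ring R]

theorem mk_eq_zero {a x : R} : (Submodule.Quotient.mk x : CyclicModule a) = 0 ↔ x ∈ leftIdeal a :=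
  Submodule.Quotient.mk_eq_zero _

theorem apply_mk {M : Type*} [AddCommGroup M] [Module R M] {a : R} (φ : CyclicModule a →ₗ[R] M)
    (r : R) :
    φ (Submodule.Quotient.mk r) = r • φ (Submodule.Quotient.mk 1) := by
  rw [← map_smul, ← Submodule.Quotient.mk_smul, smul_eq_mul, mul_one]

theorem SimBy.exists_equiv {z a b : R} (h : SimBy z a b) :
    ∃ e : CyclicModule a ≃ₗ[R] CyclicModule b,
      ∀ r, e (Submodule.Quotient.mk r) = Submodule.Quotient.mk (r * z) := by
  let g : R →ₗ[R] CyclicModule b := (leftIdeal b).mkQ ∘ₗ LinearMap.toSpanSingleton R R z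
  have hg : ∀ r, g r = Submodule.Quotient.mk (r * z) := fun _ => rfl
  have hker : leftIdeal a = LinearMap.ker g := by
    ext r
    rw [LinearMap.mem_ker, hg, mk_eq_zero, h.mem_iff]
  have hsurj : Function.Surjective g := by
    intro y
    obtain ⟨y, rfl⟩ := Submodule.Quotient.mk_surjective _ y
    obtain ⟨w, v, hwv⟩ := sup_leftIdeal_eq_top.1 h.sup_eq_top
    refine ⟨y * w, ?_⟩
    rw [hg, Submodule.Quotient.eq]
    have : y * w * z - y = -(y * v) * b := by
      calc y * w * z - y = y * w * z - y * (w * z + v * b) := by rw [hwv, mul_one]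
        _ = _ := by noncomm_ring
    rw [this]
    exact mul_mem_leftIdeal _ _
  exact ⟨(Submodule.quotEquivOfEq _ _ hker).trans (g.quotKerEquivOfSurjective hsurj),
    fun r => rfl⟩

theorem exists_simBy_of_equiv {a b : R} (e : CyclicModule a ≃ₗ[R] CyclicModule b) :
    ∃ z, SimBy z a b := by
  obtain ⟨z, hz⟩ := Submodule.Quotient.mk_surjective _ (e (Submodule.Quotient.mk 1))
  have he : ∀ r, e (Submodule.Quotient.mk r) = Submodule.Quotient.mk (r * z) := fun r => by
    rw [← LinearEquiv.coe_coe, apply_mk, LinearEquiv.coe_coe, ← hz, ← Submodule.Quotient.mk_smul,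
      smul_eq_mul]
  refine ⟨z, fun r => ?_, ?_⟩
  · rw [← mk_eq_zero, ← mk_eq_zero, ← he, LinearEquiv.map_eq_zero_iff]
  · obtain ⟨y, hy⟩ := e.surjective (Submodule.Quotient.mk 1)
    obtain ⟨w, rfl⟩ := Submodule.Quotient.mk_surjective _ y
    rw [he, eq_comm, Submodule.Quotient.eq] at hy
    obtain ⟨v, hv⟩ := mem_leftIdeal.1 hy
    exact sup_leftIdeal_eq_top.2 ⟨w, v, by rw [← hv]; abel⟩

theorem isSimilar_iff {a b : R} : IsSimilar a b ↔ a ≠ 0 ∧ b ≠ 0 ∧ ∃ z, SimBy z a b :=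
  and_congr_right fun _ => and_congr_right fun _ =>
    ⟨fun ⟨e⟩ => exists_simBy_of_equiv e, fun ⟨_, h⟩ => ⟨h.exists_equiv.choose⟩⟩

theorem IsSimilar.refl {a : R} (ha : a ≠ 0) : IsSimilar a a := ⟨ha, ha, ⟨LinearEquiv.refl R _⟩⟩

theorem IsSimilar.symm {a b : R} (h : IsSimilar a b) : IsSimilar b a :=
  ⟨h.2.1, h.1, h.2.2.map LinearEquiv.symm⟩

theorem IsSimilar.trans {a b c : R} (h : IsSimilar a b) (h' : IsSimilar b c) : IsSimilar a c :=
  ⟨h.1, h'.2.1, h.2.2.elim fun e => h'.2.2.elim fun e' => ⟨e.trans e'⟩⟩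

/-- Nonzero homomorphisms between the modules of two atoms are isomorphisms. -/
theorem IsTwoFir.simBy_of_irreducible (hR : IsTwoFir R) {p q z : R} (hp : Irreducible p)
    (hq : Irreducible q) (h : p * z ∈ leftIdeal q) (hz : z ∉ leftIdeal q) : SimBy z p q := by
  have := hR.isDomain
  obtain ⟨u, hu, hz'⟩ := hR.exists_irreducible_simBy hq hp.ne_zero h hz
  have h1 := leftIdeal_eq_of_irreducible hp hu.not_isUnit ((hz'.mem_iff p).2 h)
  exact ⟨fun r => by rw [← h1, hz'.mem_iff], hz'.sup_eq_top⟩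

theorem one_notMem_of_irreducible [IsDomain R] {q : R} (hq : Irreducible q) : (1 : R) ∉ leftIdeal q := fun h => by
  obtain ⟨r, hr⟩ := mem_leftIdeal.1 h
  exact hq.not_isUnit (IsUnit.of_mul_eq_one_right r hr.symm)

theorem IsTwoFir.nontrivial_C (hR : IsTwoFir R) {q : R} (hq : Irreducible q) :
    Nontrivial (C q) := by
  have := hR.isDomain
  have : Nontrivial (CyclicModule q) :=
    ⟨Submodule.Quotient.mk 1, 0, fun h => one_notMem_of_irreducible hq (mk_eq_zero.1 h)⟩
  infer_instance

/-- This is Schur's lemma, although `R/Rq` need not be simple: the image of the generator is killed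
by `q ≠ 0`, and a nonzero torsion element generates `R/Rq` with annihilator generated by an atom,
here `Rq` itself. -/
theorem IsTwoFir.isUnit_C (hR : IsTwoFir R) {q : R} (hq : Irreducible q) (φ : C q) (hφ : φ ≠ 0) :
    IsUnit φ := by
  obtain ⟨z, hz⟩ := Submodule.Quotient.mk_surjective _ (φ (Submodule.Quotient.mk 1))
  have hφz : ∀ r, φ (Submodule.Quotient.mk r) = Submodule.Quotient.mk (r * z) := fun r => by
    rw [apply_mk, ← hz, ← Submodule.Quotient.mk_smul, smul_eq_mul]
  have hzq : z ∉ leftIdeal q := fun h => hφ <| by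
    ext
    simp only [LinearMap.comp_apply, Submodule.mkQ_apply, hφz, one_mul, mk_eq_zero.2 h,
      LinearMap.zero_apply]
  have hqz : q * z ∈ leftIdeal q := by
    rw [← mk_eq_zero, ← hφz, mk_eq_zero.2 (self_mem_leftIdeal q), map_zero]
  obtain ⟨e, he⟩ := (hR.simBy_of_irreducible hq hq hqz hzq).exists_equiv
  have : φ = e.toLinearMap := by
    ext
    simp [hφz, he]
  rw [Module.End.isUnit_iff, this]
  exact e.bijective

theorem IsTwoFir.strongRankCondition_C (hR : IsTwoFir R) {q : R} (hq : Irreducible q) :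
    StrongRankCondition (C q) := by
  have := hR.nontrivial_C hq
  let _ : DivisionRing (C q) := DivisionRing.ofIsUnitOrEqZero fun φ =>
    (eq_or_ne φ 0).symm.imp_left (hR.isUnit_C hq φ)
  infer_instance

/-- The `e γ` sum to 1 modulo `Rp`, so some `e γ` is nonzero there. It is killed by `γ` and gives a
nonzero map `R/Rγ → R/Rp`, necessarily an isomorphism. -/
theorem IsMeetBasis.exists_isSimilar (hR : IsTwoFir R) {f m : R} (hf : f ≠ 0) {Γ : Finset R}
    (h : IsMeetBasis f Γ m) {p : R} (hp : p ∈ V f) : ∃ γ ∈ Γ, IsSimilar γ p := by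
  have := hR.isDomain
  obtain ⟨e, he, he'⟩ := h.exists_separating hR hf
  have hmp := leftIdeal_le.2 (h.mem_of_V p hp)
  obtain ⟨γ, hγ, hγp⟩ : ∃ γ ∈ Γ, e γ ∉ leftIdeal p := by
    by_contra! hcon
    apply one_notMem_of_irreducible hp.1
    have h1 := Submodule.add_mem _ (hmp (h.sum_separating he he')) (Submodule.sum_mem _ hcon)
    rwa [sub_add_cancel] at h1
  have h2 := hmp (h.mul_separating he he' hγ (self_mem_leftIdeal γ))
  exact ⟨γ, hγ, isSimilar_iff.2 ⟨(h.mem_V γ hγ).1.ne_zero, hp.1.ne_zero, _,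
    hR.simBy_of_irreducible (h.mem_V γ hγ).1 hp.1 h2 hγp⟩⟩

theorem lam_mk (f q z : R) :
    lam f q (Submodule.Quotient.mk z) = Submodule.Quotient.mk (f * z) := rfl

-- The kernel is identified with `Hom(R/Rm, R/Rq)`. In the decomposition of `R/Rm`, each `γ` similar
-- to `q` contributes a line over `C(q)` and every other `γ` contributes 0. The vector `v γ` is the
-- image of 1 under a chosen isomorphism `R/Rγ ≅ R/Rq`.
open Classical in
theorem IsMeetBasis.dimKer_eq (hR : IsTwoFir R) {f m : R} (hf : f ≠ 0) {Γ : Finset R}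
    (h : IsMeetBasis f Γ m) {q : R} (hq : Irreducible q) :
    dimKer f q = (Γ.filter (IsSimilar q)).card := by
  have := hR.isDomain
  have := hR.strongRankCondition_C hq
  obtain ⟨e, he, he'⟩ := h.exists_separating hR hf
  set T := Γ.filter (IsSimilar q) with hT
  have hTΓ : ∀ γ : T, γ.1 ∈ Γ := fun γ => (Finset.mem_filter.1 γ.2).1
  have hex : ∀ γ : T, ∃ z, SimBy z γ.1 q := fun γ =>
    (isSimilar_iff.1 (Finset.mem_filter.1 γ.2).2.symm).2.2
  choose z hz using hex
  let v : T → CyclicModule q := fun γ => Submodule.Quotient.mk (z γ)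
  have hsmul : ∀ (r : R) γ, r • v γ = 0 ↔ r ∈ leftIdeal γ.1 := fun r γ => by
    rw [(hz γ).mem_iff, ← mk_eq_zero]; rfl
  have hself : ∀ γ : T, e γ.1 • v γ = v γ := fun γ => by
    have := (hsmul _ γ).2 (he' γ.1 (hTΓ γ))
    rw [sub_smul, one_smul, sub_eq_zero] at this
    exact this.symm
  have hli : LinearIndependent (C q) v := by
    rw [Fintype.linearIndependent_iff]
    intro g hg k
    -- Scalars in `C(q)` commute with `R`, and `e k` fixes `v k` while killing the other vectors, so
    -- it isolates one coefficient.
    have h1 : e k.1 • ∑ i, g i • v i = g k • v k := by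
      rw [Finset.smul_sum, Finset.sum_eq_single k]
      · rw [Module.End.smul_def, ← map_smul, hself]
      · intro i _ hik
        rw [Module.End.smul_def, ← map_smul,
          (hsmul _ i).2 (he k.1 (hTΓ k) i.1 (hTΓ i) fun h => hik (Subtype.ext h)), map_zero]
      · exact fun h => absurd (Finset.mem_univ k) h
    rw [hg, smul_zero, eq_comm] at h1
    by_contra hgk
    have h2 := ((Module.End.isUnit_iff _).1 (hR.isUnit_C hq (g k) hgk)).1
      (h1.trans (map_zero (g k)).symm)
    rw [← one_smul R (v k), hsmul] at h2
    exact one_notMem_of_irreducible (h.mem_V k.1 (hTΓ k)).1 h2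
  have hspan : LinearMap.ker (lam f q) = Submodule.span (C q) (Set.range v) := by
    apply le_antisymm
    · intro x hx
      obtain ⟨y, rfl⟩ := Submodule.Quotient.mk_surjective _ x
      rw [LinearMap.mem_ker, lam_mk, mk_eq_zero] at hx
      -- A nonzero element killed by `f` has annihilator `Ru` with `u ∈ V(f)`, so it is already
      -- killed by `m`.
      have hm : ∀ r ∈ leftIdeal m, r * y ∈ leftIdeal q := by
        by_cases hy : y ∈ leftIdeal q
        · exact fun r _ => Submodule.smul_mem _ r hy
        · obtain ⟨u, hu, huy⟩ := hR.exists_irreducible_simBy hq hf hx hy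
          intro r hr
          rw [← huy.mem_iff]
          exact leftIdeal_le.2 (h.mem_of_V u ⟨hu, (huy.mem_iff f).2 hx⟩) hr
      have hsum : (leftIdeal q).mkQ y = ∑ γ ∈ Γ, (leftIdeal q).mkQ (e γ * y) := by
        rw [← map_sum, ← sub_eq_zero, ← map_sub, Submodule.mkQ_apply, mk_eq_zero]
        have := hm _ (h.sum_separating he he')
        rwa [sub_mul, one_mul, Finset.sum_mul] at this
      rw [← Submodule.mkQ_apply, hsum]
      refine Submodule.sum_mem _ fun γ hγ => ?_
      rw [Submodule.mkQ_apply]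
      by_cases hγq : e γ * y ∈ leftIdeal q
      · rw [mk_eq_zero.2 hγq]
        exact Submodule.zero_mem _
      · have hγV := (h.mem_V γ hγ).1
        have h1 : γ * (e γ * y) ∈ leftIdeal q := by
          rw [← mul_assoc]
          exact hm _ (h.mul_separating he he' hγ (self_mem_leftIdeal γ))
        have h2 := hR.simBy_of_irreducible hγV hq h1 hγq
        have hγT : γ ∈ T := Finset.mem_filter.2
          ⟨hγ, (isSimilar_iff.2 ⟨hγV.ne_zero, hq.ne_zero, _, h2⟩).symm⟩
        obtain ⟨e₁, he₁⟩ := (hz ⟨γ, hγT⟩).exists_equiv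
        obtain ⟨e₂, he₂⟩ := h2.exists_equiv
        -- Two isomorphisms `R/Rγ ≅ R/Rq` differ by an element of `C(q)`.
        have h3 : (Submodule.Quotient.mk (e γ * y) : CyclicModule q) =
            ((e₂.toLinearMap ∘ₗ e₁.symm.toLinearMap : C q)) • v ⟨γ, hγT⟩ := by
          have h4 : v ⟨γ, hγT⟩ = e₁ (Submodule.Quotient.mk 1) := by rw [he₁, one_mul]
          rw [h4, Module.End.smul_def]
          simp [he₂]
        rw [h3]
        exact Submodule.smul_mem _ _ (Submodule.subset_span ⟨_, rfl⟩)
    · rw [Submodule.span_le]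
      rintro _ ⟨γ, rfl⟩
      exact (hsmul f γ).2 (h.mem_V γ.1 (hTΓ γ)).2
  rw [dimKer, hspan, rank_eq_card_basis (Module.Basis.span hli), Fintype.card_coe]
  simp

theorem exists_representatives (Γ : Finset R) (hΓ : ∀ γ ∈ Γ, γ ≠ 0) :
    ∃ T ⊆ Γ, (∀ s ∈ T, ∀ t ∈ T, s ≠ t → ¬ IsSimilar s t) ∧ ∀ γ ∈ Γ, ∃ t ∈ T, IsSimilar t γ := by
  classical
  induction Γ using Finset.induction_on with
  | empty => exact ⟨∅, subset_rfl, by simp, by simp⟩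
  | insert a s has ih =>
    obtain ⟨T, hTs, hT, hcov⟩ := ih fun γ h => hΓ γ (Finset.mem_insert_of_mem h)
    by_cases ha : ∃ t ∈ T, IsSimilar t a
    · refine ⟨T, hTs.trans (Finset.subset_insert a s), hT, fun γ hγ => ?_⟩
      rcases Finset.mem_insert.1 hγ with rfl | h
      · exact ha
      · exact hcov γ h
    · push Not at ha
      refine ⟨insert a T, Finset.insert_subset_insert a hTs, ?_, fun γ hγ => ?_⟩
      · intro x hx y hy hxy
        rcases Finset.mem_insert.1 hx with rfl | hxT
        · rcases Finset.mem_insert.1 hy with rfl | hyT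
          · exact absurd rfl hxy
          · exact fun h => ha y hyT h.symm
        · rcases Finset.mem_insert.1 hy with rfl | hyT
          · exact ha x hxT
          · exact hT x hxT y hyT hxy
      · rcases Finset.mem_insert.1 hγ with rfl | h
        · exact ⟨γ, Finset.mem_insert_self _ _, .refl (hΓ γ hγ)⟩
        · obtain ⟨t, ht, htγ⟩ := hcov γ h
          exact ⟨t, Finset.mem_insert_of_mem ht, htγ⟩

theorem IsMeetBasis.exists_isSimDecomposition (hR : IsTwoFir R) {f m : R} (hf : f ≠ 0)
    {Γ : Finset R} (h : IsMeetBasis f Γ m) : ∃ (r : ℕ) (q : Fin r → R), IsSimDecomposition f q := by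
  have := hR.isDomain
  obtain ⟨T, hTΓ, hT, hcov⟩ := exists_representatives Γ fun γ hγ => (h.mem_V γ hγ).1.ne_zero
  have hV : ∀ t ∈ T, t ∈ V f := fun t ht => h.mem_V t (hTΓ ht)
  refine ⟨T.card, fun i => (T.equivFin.symm i).1, fun i => (hV _ (T.equivFin.symm i).2).1,
    fun i j hij => hT _ (T.equivFin.symm i).2 _ (T.equivFin.symm j).2 fun h => hij ?_,
    fun i => ⟨(T.equivFin.symm i).1, hV _ (T.equivFin.symm i).2,
      .refl (hV _ (T.equivFin.symm i).2).1.ne_zero⟩, ?_⟩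
  · exact T.equivFin.symm.injective (Subtype.ext h)
  · refine Set.Subset.antisymm (fun p hp => ?_) (Set.iUnion_subset fun _ => Set.inter_subset_left)
    obtain ⟨γ, hγ, hγp⟩ := h.exists_isSimilar hR hf hp
    obtain ⟨t, ht, htγ⟩ := hcov γ hγ
    refine Set.mem_iUnion.2 ⟨T.equivFin ⟨t, ht⟩, hp, ?_⟩
    change IsSimilar _ _
    rw [Equiv.symm_apply_apply]
    exact htγ.trans hγp

theorem IsMeetBasis.sum_dimKer (hR : IsTwoFir R) {f m : R} (hf : f ≠ 0)
    {Γ : Finset R} (h : IsMeetBasis f Γ m) {r : ℕ} {q : Fin r → R} (hq : IsSimDecomposition f q) :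
    ∑ i, dimKer f (q i) = Γ.card := by
  classical
  simp only [fun i => h.dimKer_eq hR hf (hq.atom i)]
  rw [← Nat.cast_sum, ← Finset.card_biUnion]
  · congr 2
    ext γ
    simp only [Finset.mem_biUnion, Finset.mem_univ, true_and, Finset.mem_filter]
    refine ⟨fun ⟨_, h, _⟩ => h, fun hγ => ?_⟩
    have h1 := h.mem_V γ hγ
    rw [hq.cover, Set.mem_iUnion] at h1
    exact h1.imp fun i hi => ⟨hγ, hi.2⟩
  · intro i _ j _ hij
    refine Finset.disjoint_left.2 fun γ hi hj => hq.not_similar i j hij ?_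
    exact (Finset.mem_filter.1 hi).2.trans (Finset.mem_filter.1 hj).2.symm

end Modules

end TwoFir

namespace TwoFir

/-! ### Fully reducible elements, their factors and the equivalences. -/

section FullyReducible

variable {R : Type u} [Ring R]

theorem isFullyReducible_of_finite {ι : Type*} [Finite ι] {f : R} (hf : f ∈ finLen R) {p : ι → R}
    (hp : ∀ i, Irreducible (p i)) (h : leftIdeal f = ⨅ i, leftIdeal (p i)) :
    IsFullyReducible f := by
  obtain ⟨n, ⟨e⟩⟩ := Finite.exists_equiv_fin ι
  exact ⟨hf, n, p ∘ e.symm, fun i => hp _, h.trans (e.symm.iInf_comp).symm⟩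

theorem isFullyReducible_of_iInf {ι : Type*} [Finite ι] {f : R} (hf : f ∈ finLen R) {g : ι → R}
    (hg : ∀ i, IsFullyReducible (g i)) (h : leftIdeal f = ⨅ i, leftIdeal (g i)) :
    IsFullyReducible f := by
  choose n p hp hgp using fun i => (hg i).2
  refine isFullyReducible_of_finite hf (ι := Σ i, Fin (n i)) (p := fun x => p x.1 x.2)
    (fun x => hp x.1 x.2) ?_
  rw [iInf_sigma, h]
  exact iInf_congr hgp

theorem isFullyReducible_one : IsFullyReducible (1 : R) :=
  ⟨mem_finLen.2 ⟨0, isProductOfAtoms_zero isUnit_one⟩, 0, Fin.elim0, fun i => i.elim0, by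
    rw [iInf_of_empty]; simp⟩

theorem isFullyReducible_of_irreducible {p : R} (hp : Irreducible p) : IsFullyReducible p :=
  ⟨mem_finLen.2 ⟨1, isProductOfAtoms_one hp⟩, 1, fun _ => p, fun _ => hp, by rw [iInf_const]⟩

/-- `Rf` is the annihilator of an element of the product of the `R/R(t i)`, hence an intersection of
annihilators of its coordinates, each of which is `R` or generated by an atom. -/
theorem isFullyReducible_of_mem_iff (hR : IsTwoFir R) {ι : Type*} [Finite ι] {f : R}
    (hf : f ∈ finLen R) {c t : ι → R} (ht : ∀ i, Irreducible (t i))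
    (h : ∀ r, r ∈ leftIdeal f ↔ ∀ i, r * c i ∈ leftIdeal (t i)) : IsFullyReducible f := by
  have := hR.isDomain
  obtain ⟨n, hn⟩ := mem_finLen.1 hf
  have key : ∀ i, ∃ g, IsFullyReducible g ∧ ∀ r, r ∈ leftIdeal g ↔ r * c i ∈ leftIdeal (t i) := by
    intro i
    by_cases hc : c i ∈ leftIdeal (t i)
    · refine ⟨1, isFullyReducible_one, fun r => iff_of_true ?_ (Submodule.smul_mem _ r hc)⟩
      rw [leftIdeal_eq_top.2 isUnit_one]
      exact Submodule.mem_top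
    · obtain ⟨u, hu, huc⟩ := hR.exists_irreducible_simBy (ht i) hn.ne_zero
        ((h f).1 (self_mem_leftIdeal f) i) hc
      exact ⟨u, isFullyReducible_of_irreducible hu, huc.mem_iff⟩
  choose g hg hgc using key
  refine isFullyReducible_of_iInf hf hg ?_
  ext r
  rw [h, Submodule.mem_iInf]
  exact forall_congr' fun i => (hgc i r).symm

theorem IsFullyReducible.colon (hR : IsTwoFir R) {f g c : R} (hg : IsFullyReducible g)
    (hf : f ∈ finLen R) (h : ∀ r, r ∈ leftIdeal f ↔ r * c ∈ leftIdeal g) : IsFullyReducible f := by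
  obtain ⟨-, n, t, ht, hgt⟩ := hg
  refine isFullyReducible_of_mem_iff hR hf (c := fun _ => c) ht fun r => ?_
  rw [h, hgt, Submodule.mem_iInf]

theorem finLen_of_mul (hR : IsTwoFir R) {x g : R} (h : x * g ∈ finLen R) :
    x ∈ finLen R ∧ g ∈ finLen R := by
  obtain ⟨n, hn⟩ := mem_finLen.1 h
  obtain ⟨i, j, hi, hj, -⟩ := hn.exists_of_mul hR
  exact ⟨mem_finLen.2 ⟨i, hi⟩, mem_finLen.2 ⟨j, hj⟩⟩

theorem IsFullyReducible.of_mul_left (hR : IsTwoFir R) {g y : R} (h : IsFullyReducible (g * y)) :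
    IsFullyReducible g := by
  have := hR.isDomain
  obtain ⟨n, hn⟩ := mem_finLen.1 h.1
  refine h.colon hR (finLen_of_mul hR h.1).1 (c := y) fun r => ?_
  simp only [mem_leftIdeal, ← mul_assoc, mul_left_inj' (right_ne_zero_of_mul hn.ne_zero)]

/-- Some `t i` has `h ∉ R(t i)`; writing `p * h = w * t i`, the parallelogram makes `h` similar to
`w`. As a left factor, `w` is fully reducible, and this is transported to `h`. -/
theorem IsFullyReducible.of_atom_mul (hR : IsTwoFir R) {p h : R} (hp : Irreducible p)
    (hf : IsFullyReducible (p * h)) : IsFullyReducible h := by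
  have := hR.isDomain
  obtain ⟨k, hk⟩ := mem_finLen.1 hf.1
  have hh := right_ne_zero_of_mul hk.ne_zero
  obtain ⟨-, n, t, ht, hft⟩ := id hf
  have hpt : ∀ i, p * h ∈ leftIdeal (t i) := fun i => by
    have h1 := hft ▸ self_mem_leftIdeal (p * h)
    exact Submodule.mem_iInf _ |>.1 h1 i
  obtain ⟨i, hi⟩ : ∃ i, h ∉ leftIdeal (t i) := by
    by_contra! hcon
    have h1 : h ∈ leftIdeal (p * h) := by rw [hft, Submodule.mem_iInf]; exact hcon
    obtain ⟨r, hr⟩ := mem_leftIdeal.1 h1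
    refine hp.not_isUnit (IsUnit.of_mul_eq_one_right r (mul_right_cancel₀ hh ?_))
    rw [mul_assoc, ← hr, one_mul]
  have h1 := hR.simBy_of_irreducible hp (ht i) (hpt i) hi
  obtain ⟨w, hw⟩ := mem_leftIdeal.1 (hpt i)
  obtain ⟨z, hz⟩ := (h1.parallelogram (ht i).ne_zero hw).exists_symm
  exact (hw ▸ hf : IsFullyReducible (w * t i)).of_mul_left hR |>.colon hR
    (finLen_of_mul hR hf.1).2 hz.mem_iff

theorem IsFullyReducible.of_mul_right (hR : IsTwoFir R) {x h : R}
    (hf : IsFullyReducible (x * h)) : IsFullyReducible h := by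
  have := hR.isDomain
  obtain ⟨k, hk⟩ := mem_finLen.1 (finLen_of_mul hR hf.1).1
  induction k generalizing x with
  | zero =>
    obtain ⟨u, rfl⟩ := hk.isUnit
    refine hf.colon hR (finLen_of_mul hR hf.1).2 (c := 1) fun r => ?_
    rw [mul_one]
    simp only [mem_leftIdeal]
    refine ⟨fun ⟨s, hs⟩ => ⟨s * ↑u⁻¹, ?_⟩, fun ⟨s, hs⟩ => ⟨s * u, by rw [hs, mul_assoc]⟩⟩
    rw [hs, mul_assoc, Units.inv_mul_cancel_left]
  | succ k ih =>
    obtain ⟨p, x', rfl, hx', hp⟩ := hk.exists_atom_mul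
    rw [mul_assoc] at hf
    exact ih (hf.of_atom_mul hR hp) hx'

theorem IsFullyReducible.of_isFactor (hR : IsTwoFir R) {f g : R} (hf : IsFullyReducible f)
    (h : IsFactor g f) : IsFullyReducible g := by
  obtain ⟨-, x, y, rfl⟩ := h
  exact (hf.of_mul_left hR).of_mul_right hR

theorem AreNeighbouringFactors.mul_left {g h f : R} (x : R) (hf : AreNeighbouringFactors g h f) :
    AreNeighbouringFactors g h (x * f) := by
  obtain ⟨⟨hg, a, b, hab⟩, ⟨hh, c, d, hcd⟩, k, l, hkl⟩ := hf
  exact ⟨⟨hg, x * a, b, by rw [hab]; noncomm_ring⟩, ⟨hh, x * c, d, by rw [hcd]; noncomm_ring⟩,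
    x * k, l, by rw [hkl]; noncomm_ring⟩

/-- An element is fully reducible if all products of two neighbouring atomic factors are. -/
theorem isFullyReducible_of_neighbouring (hR : IsTwoFir R) {n : ℕ} {f : R}
    (hf : IsProductOfAtoms f n)
    (h : ∀ g h : R, Irreducible g → Irreducible h → AreNeighbouringFactors g h f →
      IsFullyReducible (g * h)) : IsFullyReducible f := by
  have := hR.isDomain
  induction n generalizing f with
  | zero =>
    refine isFullyReducible_one.colon hR (mem_finLen.2 ⟨_, hf⟩) (c := 1) fun r => ?_
    rw [leftIdeal_eq_top.2 hf.isUnit, leftIdeal_eq_top.2 isUnit_one]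
    simp
  | succ n ih =>
    obtain ⟨p, g, rfl, hg, hp⟩ := hf.exists_atom_mul
    match n with
    | 0 =>
      exact isFullyReducible_of_irreducible ((irreducible_mul_isUnit hg.isUnit).2 hp)
    | n + 1 =>
      obtain ⟨u, k, rfl, hk, hu⟩ := hg.exists_atom_mul
      have hk0 := hk.ne_zero
      obtain ⟨-, l, t, ht, hput⟩ := h p u hp hu
        ⟨⟨hp.not_isUnit, 1, u * k, by noncomm_ring⟩, ⟨hu.not_isUnit, p, k, by noncomm_ring⟩,
          1, k, by noncomm_ring⟩
      have hmem : ∀ i, ∃ x, p * u = x * t i := fun i => mem_leftIdeal.1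
        ((Submodule.mem_iInf _).1 (hput ▸ self_mem_leftIdeal (p * u)) i)
      -- From `R(pu) = ⋂ R(t i)` follows `R(puk) = ⋂ R(t i * k)`. Each `t i * k` is a right factor
      -- of `p * u * k` with one atom fewer, so it inherits the hypothesis on neighbouring atoms.
      refine isFullyReducible_of_iInf (mem_finLen.2 ⟨_, hf⟩) (g := fun i => t i * k)
        (fun i => ih (hk.atom_mul (ht i)) fun a b ha hb hab => h a b ha hb ?_) ?_
      · obtain ⟨x, hx⟩ := hmem i
        rw [← mul_assoc, hx, mul_assoc]
        exact hab.mul_left x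
      · refine le_antisymm (le_iInf fun i => ?_) fun z hz => ?_
        · obtain ⟨x, hx⟩ := hmem i
          rw [leftIdeal_le, ← mul_assoc, hx, mul_assoc]
          exact mul_mem_leftIdeal _ _
        · rw [Submodule.mem_iInf] at hz
          -- At least one index is needed in order to write `z` as a left multiple of `k`.
          have hl : l ≠ 0 := by
            rintro rfl
            rw [iInf_of_empty, leftIdeal_eq_top] at hput
            exact hp.not_isUnit (IsUnit.mul_iff.1 hput).1
          obtain ⟨s, hs⟩ := mem_leftIdeal.1 (hz ⟨0, by omega⟩)
          rw [← mul_assoc] at hs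
          generalize s * t ⟨0, by omega⟩ = y at hs
          subst hs
          have hy : y ∈ leftIdeal (p * u) := by
            rw [hput, Submodule.mem_iInf]
            intro i
            obtain ⟨s', hs'⟩ := mem_leftIdeal.1 (hz i)
            rw [← mul_assoc] at hs'
            rw [mul_right_cancel₀ hk0 hs']
            exact mul_mem_leftIdeal _ _
          obtain ⟨s', rfl⟩ := mem_leftIdeal.1 hy
          rw [mul_assoc, mul_assoc p]
          exact mul_mem_leftIdeal _ _

/-- The condition `m ∈ Rf`, equivalent to `Rm = Rf`, is the common form to which (i), (ii) and
(viii) are reduced. -/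
theorem IsMeetBasis.isFullyReducible_iff {f m : R} (hf : f ∈ finLen R)
    {Γ : Finset R} (h : IsMeetBasis f Γ m) : IsFullyReducible f ↔ m ∈ leftIdeal f := by
  constructor
  · rintro ⟨-, n, p, hp, hfp⟩
    rw [hfp, Submodule.mem_iInf]
    refine fun i => h.mem_of_V _ ⟨hp i, ?_⟩
    exact (Submodule.mem_iInf _).1 (hfp ▸ self_mem_leftIdeal f) i
  · intro hm
    refine isFullyReducible_of_finite hf (ι := Γ) (p := fun γ => γ.1)
      (fun γ => (h.mem_V γ.1 γ.2).1) ?_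
    rw [iInf_subtype, h.iInf_eq]
    exact le_antisymm (leftIdeal_le.2 h.mem) (leftIdeal_le.2 hm)

theorem IsMeetBasis.card_eq_iff (hR : IsTwoFir R) {f m : R} {n : ℕ} (hf : IsProductOfAtoms f n)
    {Γ : Finset R} (h : IsMeetBasis f Γ m) : Γ.card = n ↔ m ∈ leftIdeal f := by
  have := hR.isDomain
  constructor
  · intro hn
    obtain ⟨s, rfl⟩ := mem_leftIdeal.1 h.mem
    obtain ⟨i, j, hi, hj, hij⟩ := hf.exists_of_mul hR
    have h1 := h.prod.unique hR hj
    obtain rfl : i = 0 := by omega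
    obtain ⟨u, rfl⟩ := hi.isUnit
    exact mem_leftIdeal.2 ⟨↑u⁻¹, by simp⟩
  · intro hm
    exact h.prod.unique hR
      (hf.congr hR (le_antisymm (leftIdeal_le.2 hm) (leftIdeal_le.2 h.mem)))

theorem IsMeetBasis.mem_iff_V {f m : R} {Γ : Finset R} (h : IsMeetBasis f Γ m) :
    m ∈ leftIdeal f ↔ ∀ g : R, V f ⊆ V g → g ∈ leftIdeal f := by
  refine ⟨fun hm g hg => leftIdeal_le.2 hm (h.mem_iff.2 fun p hp => (hg hp).2),
    fun H => H m fun p hp => ⟨hp.1, h.mem_of_V p hp⟩⟩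

theorem isFullyReducible_of_equiv (hR : IsTwoFir R) {f : R} (hf : f ∈ finLen R) {n : ℕ}
    {p : Fin n → R} (hp : ∀ i, Irreducible (p i))
    (e : CyclicModule f ≃ₗ[R] DirectSum (Fin n) fun i => CyclicModule (p i)) :
    IsFullyReducible f := by
  let e' := e.trans (DirectSum.linearEquivFunOnFintype R (Fin n) fun i => CyclicModule (p i))
  choose c hc using fun i =>
    Submodule.Quotient.mk_surjective _ (e' (Submodule.Quotient.mk 1) i)
  refine isFullyReducible_of_mem_iff hR hf hp (c := c) fun r => ?_
  rw [← mk_eq_zero, ← LinearEquiv.map_eq_zero_iff e', ← LinearEquiv.coe_coe, apply_mk, funext_iff]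
  refine forall_congr' fun i => ?_
  rw [Pi.smul_apply, LinearEquiv.coe_coe, ← hc, ← Submodule.Quotient.mk_smul, smul_eq_mul,
    Pi.zero_apply, mk_eq_zero]

/-- Chinese remainder theorem: the separating elements make `R → ∏ R/Rγ` surjective, and its kernel
is `Rm = Rf`. -/
theorem IsMeetBasis.exists_equiv (hR : IsTwoFir R) {f m : R} (hf : f ≠ 0) {Γ : Finset R}
    (h : IsMeetBasis f Γ m) (hm : m ∈ leftIdeal f) :
    ∃ (n : ℕ) (p : Fin n → R), (∀ i, Irreducible (p i)) ∧
      Nonempty (CyclicModule f ≃ₗ[R] DirectSum (Fin n) (fun i => CyclicModule (p i))) := by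
  obtain ⟨e, he, he'⟩ := h.exists_separating hR hf
  let ε := Γ.equivFin
  let p : Fin Γ.card → R := fun i => (ε.symm i).1
  have hpΓ : ∀ i, p i ∈ Γ := fun i => (ε.symm i).2
  have hpinj : Function.Injective p := Subtype.val_injective.comp ε.symm.injective
  refine ⟨Γ.card, p, fun i => (h.mem_V _ (hpΓ i)).1, ⟨?_⟩⟩
  let ψ : R →ₗ[R] (∀ i, CyclicModule (p i)) := LinearMap.pi fun i => (leftIdeal (p i)).mkQ
  have hker : leftIdeal f = LinearMap.ker ψ := by
    rw [le_antisymm (leftIdeal_le.2 h.mem) (leftIdeal_le.2 hm), ← h.iInf_eq]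
    ext r
    rw [mem_iInf_leftIdeal, LinearMap.mem_ker, funext_iff]
    refine ⟨fun H i => mk_eq_zero.2 (H _ (hpΓ i)), fun H γ hγ => ?_⟩
    have h1 := mk_eq_zero.1 (H (ε ⟨γ, hγ⟩))
    simpa [p] using h1
  have hsurj : Function.Surjective ψ := by
    intro y
    choose x hx using fun i => Submodule.Quotient.mk_surjective _ (y i)
    refine ⟨∑ i, x i * e (p i), funext fun i => ?_⟩
    rw [← hx i]
    change (leftIdeal (p i)).mkQ _ = (leftIdeal (p i)).mkQ _
    rw [map_sum, Finset.sum_eq_single i]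
    · rw [← sub_eq_zero, ← map_sub, Submodule.mkQ_apply, mk_eq_zero]
      have : x i * e (p i) - x i = -x i * (1 - e (p i)) := by noncomm_ring
      rw [this]
      exact Submodule.smul_mem _ _ (he' _ (hpΓ i))
    · intro j _ hji
      rw [Submodule.mkQ_apply, mk_eq_zero]
      exact Submodule.smul_mem _ _ (he _ (hpΓ j) _ (hpΓ i) fun h => hji (hpinj h).symm)
    · exact fun h => absurd (Finset.mem_univ i) h
  exact ((Submodule.quotEquivOfEq _ _ hker).trans (ψ.quotKerEquivOfSurjective hsurj)).trans
    (DirectSum.linearEquivFunOnFintype R (Fin Γ.card) fun i => CyclicModule (p i)).symm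

end FullyReducible

end TwoFir
theorem mainTheorem1 {R : Type u} [Ring R] (hR : TwoFir.IsTwoFir R)
    (f : R) (hf : f ∈ TwoFir.finLen R) :
    -- `C(q)` is a division ring for every atom `q`
    (∀ q : R, Irreducible q →
      Nontrivial (TwoFir.C q) ∧ ∀ φ : TwoFir.C q, φ ≠ 0 → IsUnit φ) ∧
    -- `V(f)` has an `F`-basis, and `rk V(f)` is the number of elements of any of them
    (∃ B : Set R, TwoFir.IsFBasis B (TwoFir.V f)) ∧
    (∀ B : Set R, TwoFir.IsFBasis B (TwoFir.V f) → B.encard = TwoFir.rk (TwoFir.V f)) ∧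
    -- `V(f)` meets only finitely many similarity classes
    (∃ (r : ℕ) (q : Fin r → R), TwoFir.IsSimDecomposition f q) ∧
    -- the characterizations, for any choice of representatives of these classes
    (∀ (r : ℕ) (q : Fin r → R), TwoFir.IsSimDecomposition f q →
      List.TFAE [
        TwoFir.IsFullyReducible f,
        TwoFir.rk (TwoFir.V f) = TwoFir.len f,
        TwoFir.len f = ∑ i, TwoFir.dimKer f (q i),
        ∃ (n : ℕ) (p : Fin n → R), (∀ i, Irreducible (p i)) ∧
          Nonempty (TwoFir.CyclicModule f ≃ₗ[R]
            DirectSum (Fin n) (fun i => TwoFir.CyclicModule (p i))),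
        ∀ g : R, TwoFir.IsFactor g f → TwoFir.IsFullyReducible g,
        ∀ g h : R, TwoFir.AreNeighbouringFactors g h f → TwoFir.IsFullyReducible (g * h),
        ∀ g h : R, Irreducible g → Irreducible h → TwoFir.AreNeighbouringFactors g h f →
          TwoFir.IsFullyReducible (g * h),
        ∀ g : R, TwoFir.V f ⊆ TwoFir.V g → g ∈ TwoFir.leftIdeal f]) := by
  have := hR.isDomain
  obtain ⟨n, hn⟩ := TwoFir.mem_finLen.1 hf
  obtain ⟨Γ, m, h⟩ := hR.exists_isMeetBasis hn
  have hf0 := hn.ne_zero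
  refine ⟨fun q hq => ⟨hR.nontrivial_C hq, hR.isUnit_C hq⟩, ⟨Γ, h.isFBasis hR hf0⟩,
    fun B hB => (h.encard_eq hR hn hB).trans (h.rk_eq hR hn).symm,
    h.exists_isSimDecomposition hR hf0, fun r q hq => ?_⟩
  -- Both the rank and the sum of the dimensions become `|Γ|`, so (ii) and (iii) are the same
  -- equation read in opposite directions.
  rw [h.rk_eq hR hn, h.sum_dimKer hR hf0 hq, TwoFir.len_eq hR hn]
  have hcard := h.card_eq_iff hR hn
  have hfr := h.isFullyReducible_iff hf
  tfae_have 1 ↔ 2 := by rw [Nat.cast_inj, hcard, hfr]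
  tfae_have 2 ↔ 3 := eq_comm
  tfae_have 1 → 4 := fun H => h.exists_equiv hR hf0 (hfr.1 H)
  tfae_have 4 → 1 := fun ⟨_, _, hp, ⟨e⟩⟩ => TwoFir.isFullyReducible_of_equiv hR hf hp e
  tfae_have 1 → 5 := fun H g hg => H.of_isFactor hR hg
  tfae_have 5 → 6 := fun H g k hgk => H _ ⟨fun hu => hgk.1.1 (IsUnit.mul_iff.1 hu).1, by
    obtain ⟨x, y, hxy⟩ := hgk.2.2
    exact ⟨x, y, by rw [hxy, mul_assoc x]⟩⟩
  tfae_have 6 → 7 := fun H g k _ _ => H g k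
  tfae_have 7 → 1 := TwoFir.isFullyReducible_of_neighbouring hR hn
  tfae_have 1 ↔ 8 := hfr.trans h.mem_iff_V
  tfae_finish
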